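/- Let $S$ and $T$ be finite sets of points in the Euclidean plane with $|S|=|T|=n$, each in general position (no three points collinear). Then one can add to each of $S$ and $T$ at most $\frac n2+3$ new points (Steiner points), obtaining sets $S'\supseteq S$ and $T'\supseteq T$ in general position that have compatible triangulations; moreover the bijection $f:S'\to T'$ witnessing compatibility can be chosen so that $f(S)=T$, and $r(S')\le 2\,r(S)$, $r(T')\le 2\,r(T)$, where $r(X)$ denotes the radius of the smallest closed disk containing $X$ (with $r(\emptyset)=0$). Here a triangulation of a finite point set $X$ is a maximal set of line segments between points of $X$ such that any two of the segments are disjoint or meet only in a common endpoint; its triangles are those triangles with vertices in $X$ and sides in the triangulation that contain no other point of $X$. Triangulations of $S'$ and $T'$ are compatible if there is a bijection $f:S'\to T'$ such that $(a,b,c)$ is a clockwise-oriented triangle of the first triangulation if and only if $(f(a),f(b),f(c))$ is a clockwise-oriented triangle of the second. -/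

import Mathlib

namespace CompatTri

/-- The Euclidean plane. -/
abbrev Plane : Type := EuclideanSpace ℝ (Fin 2)

/-- No three (distinct) points of `P` are collinear. -/
def GeneralPosition (P : Finset Plane) : Prop :=
  ∀ a ∈ P, ∀ b ∈ P, ∀ c ∈ P, a ≠ b → a ≠ c → b ≠ c →
    ¬ Collinear ℝ ({a, b, c} : Set Plane)

/-- A set of segments between points of `P` is recorded as a simple graph on `P`. It is non-crossing
if two different segments meet at most in a common endpoint. -/
def NonCrossing {P : Finset Plane} (G : SimpleGraph P) : Prop :=
  ∀ a b c d : P, G.Adj a b → G.Adj c d → s(a, b) ≠ s(c, d) →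
    segment ℝ (a : Plane) (b : Plane) ∩ segment ℝ (c : Plane) (d : Plane) ⊆
      {(a : Plane), (b : Plane)} ∩ {(c : Plane), (d : Plane)}

/-- A triangulation of `P` is a maximal non-crossing set of segments between points of `P`. -/
def IsTriangulation {P : Finset Plane} (G : SimpleGraph P) : Prop :=
  Maximal NonCrossing G

/-- The triple `(a, b, c)` is listed in (strictly) clockwise order. -/
def Clockwise (a b c : Plane) : Prop :=
  (b 0 - a 0) * (c 1 - a 1) - (b 1 - a 1) * (c 0 - a 0) < 0

/-- `(a, b, c)` is a clockwise-oriented triangle of `G`: its sides are segments of `G`,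
and it contains no other point of `P`. -/
def IsClockwiseTriangle {P : Finset Plane} (G : SimpleGraph P) (a b c : P) : Prop :=
  G.Adj a b ∧ G.Adj b c ∧ G.Adj c a ∧ Clockwise a b c ∧
    ∀ p : P, (p : Plane) ∈ convexHull ℝ ({(a : Plane), (b : Plane), (c : Plane)} : Set Plane) →
      p = a ∨ p = b ∨ p = c

/-- The bijection `f` maps the clockwise triangles of `G` exactly to the clockwise triangles
of `H`. -/
def CompatibleVia {P Q : Finset Plane} (G : SimpleGraph P) (H : SimpleGraph Q) (f : P ≃ Q) :
    Prop :=
  ∀ a b c : P, IsClockwiseTriangle G a b c ↔ IsClockwiseTriangle H (f a) (f b) (f c)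

/-- The radius of the smallest closed disk containing `P` (it is `0` for the empty set). -/
noncomputable def radius (P : Finset Plane) : ℝ :=
  sInf {r : ℝ | 0 ≤ r ∧ ∃ z : Plane, (P : Set Plane) ⊆ Metric.closedBall z r}

end CompatTri

/-! Enclose each of the two sets in a triangle and subdivide both triangles in the same
combinatorial way. If a triangle a b c contains n ≥ 2 points in sufficiently general position, then
some point v inside it leaves exactly one of them in v b c, exactly one in a v c and the other n - 2
in a b v (`exists_split`). Take v as a Steiner point, join it to the three corners, join each
isolated point to the corners of its part, and recurse in a b v. Every Steiner point uses up two
given points, so n / 2 rounded down suffice, besides the three outer corners. Since the counts in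
the parts are the same for S and for T, both recursions build one and the same stacked triangulation
(`exists_stack`). Its abstract vertices are pairs of points, and the two projections are its two
realizations.

A realization is a triangulation: its edges do not cross (`Valid.crossFree`) and every further
segment crosses one of them (`Valid.exists_crossing`). Its empty clockwise triangles are exactly the
combinatorial faces (`Valid.isClockwiseTriangle_iff`), which do not depend on the positions; hence
two realizations are compatible.

For the radius bound, an equilateral triangle circumscribed about a disk of radius r has its corners
at distance 2r from the center. A suitable rotation followed by a slight shrinking makes all
inequalities strict (`exists_triangle`), which leaves room to perturb the corners into general
position (`exists_generic_triangle`). -/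

namespace CompatTri

/-! ### Signed areas and triangles -/

/-- Twice the signed area of the triangle `a b c`, positive when it is clockwise. -/
def ar (a b c : Plane) : ℝ :=
  (b 1 - a 1) * (c 0 - a 0) - (b 0 - a 0) * (c 1 - a 1)

theorem clockwise_iff {a b c : Plane} : Clockwise a b c ↔ 0 < ar a b c := by
  unfold Clockwise ar
  constructor <;> intro h <;> linarith

theorem ar_rot (a b c : Plane) : ar a b c = ar b c a := by
  simp only [ar]; ring

theorem ar_swap (a b c : Plane) : ar a b c = -ar b a c := by
  simp only [ar]; ring

theorem ar_swap_right (a b c : Plane) : ar a b c = -ar a c b := by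
  simp only [ar]; ring

theorem ar_self_left (a b : Plane) : ar a a b = 0 := by
  simp only [ar]; ring

theorem ar_self_right (a b : Plane) : ar a b b = 0 := by
  simp only [ar]; ring

theorem ar_self_outer (a b : Plane) : ar a b a = 0 := by
  simp only [ar]; ring

theorem ar_sum (a b c p : Plane) : ar p b c + ar a p c + ar a b p = ar a b c := by
  simp only [ar]; ring

/-- The areas of the three parts are the barycentric coordinates of `p`, kept free of division. -/
theorem ar_smul_eq (a b c p : Plane) :
    ar a b c • p = ar p b c • a + ar a p c • b + ar a b p • c := by
  ext i
  fin_cases i <;> simp [ar] <;> ring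

theorem ar_comb {s t : ℝ} (h : s + t = 1) (p q u w : Plane) :
    ar (s • p + t • q) u w = s * ar p u w + t * ar q u w := by
  obtain rfl : s = 1 - t := by linarith
  simp [ar]; ring

@[fun_prop]
theorem continuous_ar {X : Type*} [TopologicalSpace X] {f g h : X → Plane} (hf : Continuous f)
    (hg : Continuous g) (hh : Continuous h) : Continuous fun x => ar (f x) (g x) (h x) := by
  unfold ar
  fun_prop

theorem collinear_iff_ar_eq_zero (a b c : Plane) :
    Collinear ℝ ({a, b, c} : Set Plane) ↔ ar a b c = 0 := by
  rw [collinear_iff_of_mem (p₀ := a) (by simp)]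
  constructor
  · rintro ⟨v, hv⟩
    obtain ⟨s, hs⟩ := hv b (by simp)
    obtain ⟨t, ht⟩ := hv c (by simp)
    subst hs ht
    simp [ar]; ring
  · intro h
    by_cases hab : b = a
    · subst hab
      refine ⟨c - b, ?_⟩
      simp only [Set.mem_insert_iff, Set.mem_singleton_iff]
      rintro p (rfl | rfl | rfl)
      · exact ⟨0, by simp⟩
      · exact ⟨0, by simp⟩
      · exact ⟨1, by simp⟩
    · refine ⟨b - a, ?_⟩
      simp only [Set.mem_insert_iff, Set.mem_singleton_iff]
      rintro p (rfl | rfl | rfl)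
      · exact ⟨0, by simp⟩
      · exact ⟨1, by simp⟩
      · have hne : (b 0 - a 0) ≠ 0 ∨ (b 1 - a 1) ≠ 0 := by
          by_contra! hcon
          apply hab
          ext i
          fin_cases i
          · simpa [sub_eq_zero] using hcon.1
          · simpa [sub_eq_zero] using hcon.2
        unfold ar at h
        rcases hne with h0 | h0
        · refine ⟨(p 0 - a 0) / (b 0 - a 0), ?_⟩
          ext i
          fin_cases i <;> simp <;> field_simp <;> linarith
        · refine ⟨(p 1 - a 1) / (b 1 - a 1), ?_⟩
          ext i
          fin_cases i <;> simp <;> field_simp <;> linarith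

/-- `p` lies in the open clockwise triangle `a b c`. -/
def InTri (a b c p : Plane) : Prop := 0 < ar p b c ∧ 0 < ar a p c ∧ 0 < ar a b p

/-- `p` lies in the closed clockwise triangle `a b c`. -/
def InClosedTri (a b c p : Plane) : Prop := 0 ≤ ar p b c ∧ 0 ≤ ar a p c ∧ 0 ≤ ar a b p

theorem InTri.closed {a b c p : Plane} (h : InTri a b c p) : InClosedTri a b c p :=
  ⟨h.1.le, h.2.1.le, h.2.2.le⟩

theorem InTri.ar_pos {a b c p : Plane} (h : InTri a b c p) : 0 < ar a b c := by
  have := ar_sum a b c p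
  obtain ⟨h1, h2, h3⟩ := h
  linarith

theorem InTri.rot {a b c p : Plane} (h : InTri a b c p) : InTri b c a p := by
  obtain ⟨h1, h2, h3⟩ := h
  exact ⟨by rwa [← ar_rot a], by rwa [← ar_rot a], by rwa [← ar_rot p]⟩

theorem InClosedTri.rot {a b c p : Plane} (h : InClosedTri a b c p) : InClosedTri b c a p := by
  obtain ⟨h1, h2, h3⟩ := h
  exact ⟨by rwa [← ar_rot a], by rwa [← ar_rot a], by rwa [← ar_rot p]⟩

theorem inClosedTri_corners {a b c : Plane} (h : 0 < ar a b c) :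
    InClosedTri a b c a ∧ InClosedTri a b c b ∧ InClosedTri a b c c := by
  simp [InClosedTri, ar_self_left, ar_self_right, ar_self_outer, h.le]

theorem convex_inClosedTri (a b c : Plane) : Convex ℝ {p | InClosedTri a b c p} := by
  rintro p ⟨p1, p2, p3⟩ q ⟨q1, q2, q3⟩ s t hs ht hst
  refine ⟨?_, ?_, ?_⟩
  · rw [ar_comb hst]; positivity
  · rw [ar_rot, ar_comb hst, ← ar_rot, ← ar_rot a]; positivity
  · rw [← ar_rot, ar_comb hst, ar_rot, ar_rot q]; positivity

/-- The part of a closed triangle lying on the line of a side is that side. -/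
theorem InClosedTri.mem_segment {a b c p : Plane} (h : InClosedTri a b c p) (hpos : 0 < ar a b c)
    (h0 : ar a p c = 0) : p ∈ segment ℝ a c := by
  obtain ⟨h1, h2, h3⟩ := h
  have hs := ar_sum a b c p
  refine ⟨ar p b c / ar a b c, ar a b p / ar a b c, by positivity, by positivity, ?_, ?_⟩
  · field_simp; linarith
  · have := ar_smul_eq a b c p
    rw [h0, zero_smul, add_zero] at this
    have h4 : p = (ar a b c)⁻¹ • (ar a b c • p) := by
      rw [smul_smul, inv_mul_cancel₀ hpos.ne', one_smul]
    nth_rewrite 3 [h4]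
    rw [this, smul_add, smul_smul, smul_smul, div_eq_inv_mul, div_eq_inv_mul]

theorem InClosedTri.mem_convexHull {a b c p : Plane} (h : InClosedTri a b c p)
    (hpos : 0 < ar a b c) : p ∈ convexHull ℝ ({a, b, c} : Set Plane) := by
  have hs := ar_sum a b c p
  obtain ⟨h1, h2, h3⟩ := h
  have h4 : p = (ar p b c / ar a b c) • a + (ar a p c / ar a b c) • b
      + (ar a b p / ar a b c) • c := by
    have h4 : p = (ar a b c)⁻¹ • (ar a b c • p) := by
      rw [smul_smul, inv_mul_cancel₀ hpos.ne', one_smul]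
    nth_rewrite 1 [h4]
    rw [ar_smul_eq a b c p, smul_add, smul_add, smul_smul, smul_smul, smul_smul,
      div_eq_inv_mul, div_eq_inv_mul, div_eq_inv_mul]
  rw [h4]
  have hsum := (convex_convexHull ℝ ({a, b, c} : Set Plane)).sum_mem (t := Finset.univ)
    (w := ![ar p b c / ar a b c, ar a p c / ar a b c, ar a b p / ar a b c]) (z := ![a, b, c])
    (by intro i _; fin_cases i <;> simp <;> positivity)
    (by simp [Fin.sum_univ_three]; field_simp; linarith)
    (by intro i _; apply subset_convexHull; fin_cases i <;> simp)
  simpa [Fin.sum_univ_three] using hsum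

theorem inClosedTri_of_mem_convexHull {a b c p : Plane} (h : 0 < ar a b c)
    (hp : p ∈ convexHull ℝ ({a, b, c} : Set Plane)) : InClosedTri a b c p := by
  refine convexHull_min ?_ (convex_inClosedTri a b c) hp
  obtain ⟨ha, hb, hc⟩ := inClosedTri_corners h
  rintro x (rfl | rfl | rfl) <;> assumption

/-- Substituting the barycentric coordinates of `v` into those of `x` expresses the areas of `x` as
positive combinations. -/
theorem InTri.sub {a b c v x : Plane} (hv : InTri a b c v) (hx : InTri v b c x) :
    InTri a b c x := by
  have hpos := hx.ar_pos
  have habc := hv.ar_pos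
  obtain ⟨v1, v2, v3⟩ := hv
  obtain ⟨x1, x2, x3⟩ := hx
  refine ⟨x1, ?_, ?_⟩
  · have h : ar v b c * ar a x c = ar x b c * ar a v c + ar v x c * ar a b c := by
      simp only [ar]; ring
    exact pos_of_mul_pos_right (h ▸ by positivity) hpos.le
  · have h : ar v b c * ar a b x = ar x b c * ar a b v + ar v b x * ar a b c := by
      simp only [ar]; ring
    exact pos_of_mul_pos_right (h ▸ by positivity) hpos.le

/-- A segment starting in a triangle away from two of its sides and leaving it on the inner side of
the third one crosses one of the first two sides. -/
theorem exists_exit {v b c p q : Plane} (hpos : 0 < ar v b c) (hp0 : 0 ≤ ar p b c)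
    (hq0 : 0 ≤ ar q b c) (hp1 : 0 < ar v p c) (hp2 : 0 < ar v b p)
    (hq : ¬ InClosedTri v b c q) :
    ∃ w ∈ segment ℝ p q, w ≠ p ∧ w ≠ q ∧ (w ∈ segment ℝ v c ∨ w ∈ segment ℝ v b) := by
  -- The minimum of the areas at the two sides through `v` is positive at `p` and negative at `q`;
  -- where it vanishes, one area is zero and the other is nonnegative, so the point lies on a side
  -- and not merely on its line.
  let g : Plane → ℝ := fun w => min (ar v w c) (ar v b w)
  have hg : Continuous g := by fun_prop
  have hgp : 0 < g p := lt_min hp1 hp2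
  have hgq : g q < 0 := by
    by_contra! hcon
    exact hq ⟨hq0, (le_min_iff.1 hcon).1, (le_min_iff.1 hcon).2⟩
  have hconn : IsPreconnected (segment ℝ p q) := (convex_segment p q).isPreconnected
  obtain ⟨w, hw, hw0⟩ := hconn.intermediate_value (right_mem_segment ℝ p q)
    (left_mem_segment ℝ p q) hg.continuousOn ⟨hgq.le, hgp.le⟩
  refine ⟨w, hw, ?_, ?_, ?_⟩
  · rintro rfl; exact hgp.ne' hw0
  · rintro rfl; exact hgq.ne hw0
  have hge : 0 ≤ ar v w c ∧ 0 ≤ ar v b w := le_min_iff.1 hw0.ge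
  have hwb : 0 ≤ ar w b c := by
    obtain ⟨s, t, hs, ht, hst, rfl⟩ := hw
    rw [ar_comb hst]; positivity
  have hin : InClosedTri v b c w := ⟨hwb, hge⟩
  rcases min_choice (ar v w c) (ar v b w) with h | h
  · left
    exact hin.mem_segment hpos (h.symm.trans hw0)
  · right
    have h0 : ar v b w = 0 := h.symm.trans hw0
    rw [segment_symm]
    refine hin.rot.mem_segment (by rwa [← ar_rot]) ?_
    rwa [← ar_rot v]

/-! ### Stacked triangulations and their realizations -/

/-- A stacked triangulation of a triangle, as a combinatorial object: either the triangle itself, or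
a vertex joined to the three corners and a stacked triangulation of each of the three parts. -/
inductive Stack (α : Type*) : Type _
  | leaf : Stack α
  | node (v : α) (t₁ t₂ t₃ : Stack α) : Stack α

namespace Stack

variable {α : Type*}

/-- The vertices other than the three corners. -/
def inner : Stack α → Set α
  | leaf => ∅
  | node v t₁ t₂ t₃ => insert v (inner t₁ ∪ inner t₂ ∪ inner t₃)

/-- All vertices, the corners included. -/
def verts (t : Stack α) (a b c : α) : Set α := {a, b, c} ∪ inner t

/-- The edges of a stacked triangulation with corners `a b c`. -/
def Edge : Stack α → α → α → α → α → α → Prop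
  | leaf, a, b, c, x, y => x ≠ y ∧ (x = a ∨ x = b ∨ x = c) ∧ (y = a ∨ y = b ∨ y = c)
  | node v t₁ t₂ t₃, a, b, c, x, y =>
      Edge t₁ v b c x y ∨ Edge t₂ a v c x y ∨ Edge t₃ a b v x y

/-- The faces of a stacked triangulation with corners `a b c`. -/
def Face : Stack α → α → α → α → α → α → α → Prop
  | leaf, a, b, c, x, y, z =>
      (x = a ∧ y = b ∧ z = c) ∨ (x = b ∧ y = c ∧ z = a) ∨ (x = c ∧ y = a ∧ z = b)
  | node v t₁ t₂ t₃, a, b, c, x, y, z =>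
      Face t₁ v b c x y z ∨ Face t₂ a v c x y z ∨ Face t₃ a b v x y z

/-- The positions `π` realize the stacked triangulation in the plane. -/
def Valid (π : α → Plane) : Stack α → α → α → α → Prop
  | leaf, a, b, c => 0 < ar (π a) (π b) (π c)
  | node v t₁ t₂ t₃, a, b, c =>
      InTri (π a) (π b) (π c) (π v) ∧ Valid π t₁ v b c ∧ Valid π t₂ a v c ∧ Valid π t₃ a b v

variable {π : α → Plane}

theorem Valid.ar_pos {t : Stack α} {a b c : α} (h : Valid π t a b c) :
    0 < ar (π a) (π b) (π c) := by
  cases t with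
  | leaf => exact h
  | node v t₁ t₂ t₃ => exact h.1.ar_pos

theorem Valid.ne {t : Stack α} {a b c : α} (h : Valid π t a b c) : a ≠ b ∧ b ≠ c ∧ c ≠ a := by
  have := h.ar_pos
  refine ⟨?_, ?_, ?_⟩ <;> rintro rfl <;>
    simp [ar_self_left, ar_self_right, ar_self_outer] at this

theorem Valid.inTri {t : Stack α} : ∀ {a b c : α}, Valid π t a b c → ∀ x ∈ inner t,
    InTri (π a) (π b) (π c) (π x) := by
  induction t with
  | leaf => intro a b c _ x hx; exact hx.elim
  | node v t₁ t₂ t₃ ih₁ ih₂ ih₃ =>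
    rintro a b c ⟨hv, h1, h2, h3⟩ x (rfl | (hx | hx) | hx)
    · exact hv
    · exact hv.sub (ih₁ h1 x hx)
    · exact (hv.rot.sub (ih₂ h2 x hx).rot).rot.rot
    · exact (hv.rot.rot.sub (ih₃ h3 x hx).rot.rot).rot

theorem Valid.inClosedTri {t : Stack α} {a b c : α} (h : Valid π t a b c) {x : α}
    (hx : x ∈ verts t a b c) : InClosedTri (π a) (π b) (π c) (π x) := by
  obtain ⟨ha, hb, hc⟩ := inClosedTri_corners h.ar_pos
  rcases hx with (rfl | rfl | rfl) | hx
  · exact ha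
  · exact hb
  · exact hc
  · exact (h.inTri x hx).closed

section cells

variable {v : α} {t₁ t₂ t₃ : Stack α} {a b c : α}

theorem mem_verts_node {x : α} : x ∈ verts (node v t₁ t₂ t₃) a b c ↔
    x ∈ verts t₁ v b c ∨ x ∈ verts t₂ a v c ∨ x ∈ verts t₃ a b v := by
  simp only [verts, inner, Set.mem_union, Set.mem_insert_iff, Set.mem_singleton_iff]
  tauto

/-- Turns geometric position into combinatorial membership: every vertex not belonging to the part
is strictly on the wrong side of a line through `v` and a corner. -/
theorem Valid.mem_cell₁ (h : Valid π (node v t₁ t₂ t₃) a b c) {x : α}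
    (hx : x ∈ verts (node v t₁ t₂ t₃) a b c)
    (hin : InClosedTri (π v) (π b) (π c) (π x)) : x ∈ verts t₁ v b c := by
  obtain ⟨hv, h1, h2, h3⟩ := h
  obtain ⟨-, i2, i3⟩ := hin
  rcases hx with (rfl | rfl | rfl) | rfl | (hx | hx) | hx
  · have := hv.2.2
    simp only [ar] at *; linarith
  · simp [verts]
  · simp [verts]
  · simp [verts]
  · exact Or.inr hx
  · have := (h2.inTri x hx).1
    simp only [ar] at *; linarith
  · have := (h3.inTri x hx).1
    simp only [ar] at *; linarith

theorem Valid.mem_cell₂ (h : Valid π (node v t₁ t₂ t₃) a b c) {x : α}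
    (hx : x ∈ verts (node v t₁ t₂ t₃) a b c)
    (hin : InClosedTri (π a) (π v) (π c) (π x)) : x ∈ verts t₂ a v c := by
  obtain ⟨hv, h1, h2, h3⟩ := h
  obtain ⟨i1, -, i3⟩ := hin
  rcases hx with (rfl | rfl | rfl) | rfl | (hx | hx) | hx
  · simp [verts]
  · have := hv.2.2
    simp only [ar] at *; linarith
  · simp [verts]
  · simp [verts]
  · have := (h1.inTri x hx).2.1
    simp only [ar] at *; linarith
  · exact Or.inr hx
  · have := (h3.inTri x hx).2.1
    simp only [ar] at *; linarith

theorem Valid.mem_cell₃ (h : Valid π (node v t₁ t₂ t₃) a b c) {x : α}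
    (hx : x ∈ verts (node v t₁ t₂ t₃) a b c)
    (hin : InClosedTri (π a) (π b) (π v) (π x)) : x ∈ verts t₃ a b v := by
  obtain ⟨hv, h1, h2, h3⟩ := h
  obtain ⟨i1, i2, -⟩ := hin
  rcases hx with (rfl | rfl | rfl) | rfl | (hx | hx) | hx
  · simp [verts]
  · simp [verts]
  · have := hv.2.1
    simp only [ar] at *; linarith
  · simp [verts]
  · have := (h1.inTri x hx).2.2
    simp only [ar] at *; linarith
  · have := (h2.inTri x hx).2.2
    simp only [ar] at *; linarith
  · exact Or.inr hx

end cells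

theorem Valid.injOn {t : Stack α} : ∀ {a b c : α}, Valid π t a b c →
    Set.InjOn π (verts t a b c) := by
  induction t with
  | leaf =>
    intro a b c h x hx y hy hxy
    have h : 0 < ar (π a) (π b) (π c) := h
    simp only [verts, inner, Set.union_empty, Set.mem_insert_iff, Set.mem_singleton_iff] at hx hy
    rcases hx with rfl | rfl | rfl <;> rcases hy with rfl | rfl | rfl <;>
      first
        | rfl
        | (rw [hxy] at h; simp [ar_self_left, ar_self_right, ar_self_outer] at h)
  | node v t₁ t₂ t₃ ih₁ ih₂ ih₃ =>
    intro a b c h x hx y hy hxy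
    rcases mem_verts_node.1 hx with hx' | hx' | hx'
    · exact ih₁ h.2.1 hx' (h.mem_cell₁ hy (hxy ▸ h.2.1.inClosedTri hx')) hxy
    · exact ih₂ h.2.2.1 hx' (h.mem_cell₂ hy (hxy ▸ h.2.2.1.inClosedTri hx')) hxy
    · exact ih₃ h.2.2.2 hx' (h.mem_cell₃ hy (hxy ▸ h.2.2.2.inClosedTri hx')) hxy

theorem Edge.symm {t : Stack α} : ∀ {a b c x y : α}, Edge t a b c x y → Edge t a b c y x := by
  induction t with
  | leaf => rintro a b c x y ⟨h, h1, h2⟩; exact ⟨h.symm, h2, h1⟩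
  | node v t₁ t₂ t₃ ih₁ ih₂ ih₃ =>
    rintro a b c x y (h | h | h)
    · exact Or.inl (ih₁ h)
    · exact Or.inr (Or.inl (ih₂ h))
    · exact Or.inr (Or.inr (ih₃ h))

theorem Edge.ne {t : Stack α} : ∀ {a b c x y : α}, Edge t a b c x y → x ≠ y := by
  induction t with
  | leaf => rintro a b c x y ⟨h, -, -⟩; exact h
  | node v t₁ t₂ t₃ ih₁ ih₂ ih₃ =>
    rintro a b c x y (h | h | h)
    · exact ih₁ h
    · exact ih₂ h
    · exact ih₃ h

theorem Edge.mem_left {t : Stack α} :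
    ∀ {a b c x y : α}, Edge t a b c x y → x ∈ verts t a b c := by
  induction t with
  | leaf => rintro a b c x y ⟨h, hx, -⟩; exact Or.inl hx
  | node v t₁ t₂ t₃ ih₁ ih₂ ih₃ =>
    rintro a b c x y (h | h | h) <;> rw [mem_verts_node]
    · exact Or.inl (ih₁ h)
    · exact Or.inr (Or.inl (ih₂ h))
    · exact Or.inr (Or.inr (ih₃ h))

theorem Edge.mem_right {t : Stack α} {a b c x y : α} (h : Edge t a b c x y) :
    y ∈ verts t a b c :=
  h.symm.mem_left

theorem Valid.edges {t : Stack α} : ∀ {a b c : α}, Valid π t a b c →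
    Edge t a b c a b ∧ Edge t a b c b c ∧ Edge t a b c c a := by
  induction t with
  | leaf =>
    intro a b c h
    obtain ⟨hab, hbc, hca⟩ := h.ne
    simp [Edge, hab, hbc, hca]
  | node v t₁ t₂ t₃ ih₁ ih₂ ih₃ =>
    rintro a b c ⟨hv, h1, h2, h3⟩
    exact ⟨Or.inr (Or.inr (ih₃ h3).1), Or.inl (ih₁ h1).2.1, Or.inr (Or.inl (ih₂ h2).2.2)⟩

theorem Valid.segment_subset {t : Stack α} {a b c x y : α} (h : Valid π t a b c)
    (he : Edge t a b c x y) :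
    segment ℝ (π x) (π y) ⊆ {p | InClosedTri (π a) (π b) (π c) p} :=
  (convex_inClosedTri _ _ _).segment_subset (h.inClosedTri he.mem_left)
    (h.inClosedTri he.mem_right)

/-! ### Edges do not cross -/

/-- Different edges of the two families meet at most in a common endpoint. -/
def CrossFree (π : α → Plane) (E E' : α → α → Prop) : Prop :=
  ∀ x y z w, E x y → E' z w → s(x, y) ≠ s(z, w) →
    segment ℝ (π x) (π y) ∩ segment ℝ (π z) (π w) ⊆ {π x, π y} ∩ {π z, π w}

theorem CrossFree.swap {E E' : α → α → Prop} (h : CrossFree π E E') : CrossFree π E' E := by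
  intro x y z w hE hE' hne
  rw [Set.inter_comm, Set.inter_comm {π x, π y}]
  exact h z w x y hE' hE hne.symm

/-- The two parts meet only along the segment from `v` to `k`, which is an edge of both. A common
point of an edge of each part therefore lies on this edge, and non-crossing within each part makes
it an endpoint on both sides. -/
theorem CrossFree.glue {t t' : Stack α} {a b c a' b' c' v k : α}
    (h : Valid π t a b c) (h' : Valid π t' a' b' c')
    (hE : CrossFree π (Edge t a b c) (Edge t a b c))
    (hE' : CrossFree π (Edge t' a' b' c') (Edge t' a' b' c'))
    (hk : Edge t a b c v k) (hk' : Edge t' a' b' c' v k)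
    (hsub : ∀ p, InClosedTri (π a) (π b) (π c) p → InClosedTri (π a') (π b') (π c') p →
      p ∈ segment ℝ (π v) (π k)) :
    CrossFree π (Edge t a b c) (Edge t' a' b' c') := by
  intro x y z w hxy hzw hne
  by_cases h1 : s(x, y) = s(v, k)
  · refine hE' x y z w ?_ hzw hne
    rcases Sym2.eq_iff.1 h1 with ⟨rfl, rfl⟩ | ⟨rfl, rfl⟩
    · exact hk'
    · exact hk'.symm
  by_cases h2 : s(z, w) = s(v, k)
  · refine hE x y z w hxy ?_ hne
    rcases Sym2.eq_iff.1 h2 with ⟨rfl, rfl⟩ | ⟨rfl, rfl⟩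
    · exact hk
    · exact hk.symm
  rintro p ⟨hp, hp'⟩
  have hvk := hsub p (h.segment_subset hxy hp) (h'.segment_subset hzw hp')
  exact ⟨(hE x y v k hxy hk h1 ⟨hp, hvk⟩).1, (hE' z w v k hzw hk' h2 ⟨hp', hvk⟩).1⟩

theorem eq_of_mem_segment_inter {x y z p : Plane} (h : ar x y z ≠ 0) (hp : p ∈ segment ℝ x y)
    (hp' : p ∈ segment ℝ x z) : p = x := by
  obtain ⟨s, t, hs, ht, hst, rfl⟩ := hp
  obtain ⟨s', t', hs', ht', hst', he⟩ := hp'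
  have h1 : ar (s • x + t • y) z x = 0 := by
    rw [← he, ar_comb hst']; simp [ar_self_left, ar_self_outer]
  rw [ar_comb hst, ar_self_outer, ← ar_rot, mul_zero, zero_add] at h1
  obtain rfl : t = 0 := (mul_eq_zero.1 h1).resolve_right h
  obtain rfl : s = 1 := by linarith
  simp

section cells

variable {v : α} {t₁ t₂ t₃ : Stack α} {a b c : α}

theorem Valid.cell₁₂ (h : Valid π (node v t₁ t₂ t₃) a b c) (p : Plane)
    (h1 : InClosedTri (π v) (π b) (π c) p) (h2 : InClosedTri (π a) (π v) (π c) p) :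
    p ∈ segment ℝ (π v) (π c) := by
  refine h1.mem_segment h.1.1 (le_antisymm ?_ h1.2.1)
  have := h2.1
  rw [ar_swap] at this
  linarith

theorem Valid.cell₂₃ (h : Valid π (node v t₁ t₂ t₃) a b c) (p : Plane)
    (h1 : InClosedTri (π a) (π v) (π c) p) (h2 : InClosedTri (π a) (π b) (π v) p) :
    p ∈ segment ℝ (π v) (π a) := by
  rw [segment_symm]
  refine h2.mem_segment h.1.2.2 (le_antisymm ?_ h2.2.1)
  have := h1.2.2
  rw [ar_swap_right] at this
  linarith

theorem Valid.cell₁₃ (h : Valid π (node v t₁ t₂ t₃) a b c) (p : Plane)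
    (h1 : InClosedTri (π v) (π b) (π c) p) (h2 : InClosedTri (π a) (π b) (π v) p) :
    p ∈ segment ℝ (π v) (π b) := by
  rw [segment_symm]
  refine h1.rot.mem_segment (by rw [← ar_rot]; exact h.1.1) (le_antisymm ?_ ?_)
  · have := h2.1
    simp only [ar] at *; linarith
  · have := h1.2.2
    simp only [ar] at *; linarith

end cells

theorem Valid.crossFree {t : Stack α} : ∀ {a b c : α}, Valid π t a b c →
    CrossFree π (Edge t a b c) (Edge t a b c) := by
  induction t with
  | leaf =>
    rintro a b c h x y z w ⟨hxy, hx, hy⟩ ⟨hzw, hz, hw⟩ hne p ⟨hp, hp'⟩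
    have h : 0 < ar (π a) (π b) (π c) := h
    have key : ∀ x y z, (x = a ∨ x = b ∨ x = c) → (y = a ∨ y = b ∨ y = c) →
        (z = a ∨ z = b ∨ z = c) → x ≠ y → x ≠ z → y ≠ z → ar (π x) (π y) (π z) ≠ 0 := by
      rintro x y z (rfl | rfl | rfl) (rfl | rfl | rfl) (rfl | rfl | rfl) h1 h2 h3 h0 <;>
        first
          | exact h1 rfl
          | exact h2 rfl
          | exact h3 rfl
          | (simp only [ar] at *; linarith)
    -- Two edges on only three vertices share a vertex.
    have hcommon : (x = z ∨ x = w) ∨ (y = z ∨ y = w) := by grind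
    rcases hcommon with (rfl | rfl) | (rfl | rfl)
    · have hyw : y ≠ w := by rintro rfl; exact hne rfl
      have := eq_of_mem_segment_inter (key x y w hx hy hw hxy hzw hyw) hp hp'
      simp [this]
    · rw [segment_symm] at hp'
      have hyz : y ≠ z := by rintro rfl; exact hne Sym2.eq_swap
      have := eq_of_mem_segment_inter (key x y z hx hy hz hxy hzw.symm hyz) hp hp'
      simp [this]
    · rw [segment_symm] at hp
      have hxw : x ≠ w := by rintro rfl; exact hne Sym2.eq_swap
      have := eq_of_mem_segment_inter (key y x w hy hx hw hxy.symm hzw hxw) hp hp'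
      simp [this]
    · rw [segment_symm] at hp hp'
      have hxz : x ≠ z := by rintro rfl; exact hne rfl
      have := eq_of_mem_segment_inter (key y x z hy hx hz hxy.symm hzw.symm hxz) hp hp'
      simp [this]
  | node v t₁ t₂ t₃ ih₁ ih₂ ih₃ =>
    intro a b c h
    obtain ⟨-, h1, h2, h3⟩ := id h
    have c1 := ih₁ h1
    have c2 := ih₂ h2
    have c3 := ih₃ h3
    have c12 := CrossFree.glue h1 h2 c1 c2 h1.edges.2.2.symm h2.edges.2.1 h.cell₁₂
    have c13 := CrossFree.glue h1 h3 c1 c3 h1.edges.1 h3.edges.2.1.symm h.cell₁₃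
    have c23 := CrossFree.glue h2 h3 c2 c3 h2.edges.1.symm h3.edges.2.2 h.cell₂₃
    rintro x y z w (e | e | e) (e' | e' | e')
    · exact c1 x y z w e e'
    · exact c12 x y z w e e'
    · exact c13 x y z w e e'
    · exact c12.swap x y z w e e'
    · exact c2 x y z w e e'
    · exact c23 x y z w e e'
    · exact c13.swap x y z w e e'
    · exact c23.swap x y z w e e'
    · exact c3 x y z w e e'

end Stack
end CompatTri

/-! ### Maximality -/

namespace CompatTri
namespace Stack

variable {α : Type*} {π : α → Plane}

/-- Every segment between two vertices that is not an edge crosses an edge. -/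
theorem Valid.exists_crossing {t : Stack α} : ∀ {a b c : α}, Valid π t a b c →
    ∀ x ∈ verts t a b c, ∀ y ∈ verts t a b c, x ≠ y → ¬ Edge t a b c x y →
    ∃ z w, Edge t a b c z w ∧ ∃ p ∈ segment ℝ (π x) (π y) ∩ segment ℝ (π z) (π w),
      p ≠ π x ∧ p ≠ π y := by
  induction t with
  | leaf =>
    intro a b c h x hx y hy hxy hne
    simp only [verts, inner, Set.union_empty, Set.mem_insert_iff, Set.mem_singleton_iff] at hx hy
    exact (hne ⟨hxy, hx, hy⟩).elim
  | node v t₁ t₂ t₃ ih₁ ih₂ ih₃ =>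
    intro a b c h x hx y hy hxy hne
    obtain ⟨hv, h1, h2, h3⟩ := id h
    simp only [Edge, not_or] at hne
    have hedge : ∀ k, (k = a ∨ k = b ∨ k = c) → Edge (node v t₁ t₂ t₃) a b c v k := by
      rintro k (rfl | rfl | rfl)
      · exact Or.inr (Or.inl h2.edges.1.symm)
      · exact Or.inl h1.edges.1
      · exact Or.inl h1.edges.2.2.symm
    -- a vertex in the relative interior of one part and a vertex outside that part
    have exit₁ : ∀ x ∈ verts t₁ v b c, x ∉ verts t₂ a v c → x ∉ verts t₃ a b v →
        ∀ y ∈ verts (node v t₁ t₂ t₃) a b c, y ∉ verts t₁ v b c →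
        ∃ z w, Edge (node v t₁ t₂ t₃) a b c z w ∧
          ∃ p ∈ segment ℝ (π x) (π y) ∩ segment ℝ (π z) (π w), p ≠ π x ∧ p ≠ π y := by
      intro x x1 x2 x3 y hy y1
      have hx := mem_verts_node.2 (Or.inl x1 : _ ∨ x ∈ verts t₂ a v c ∨ x ∈ verts t₃ a b v)
      have hx1 := h1.inClosedTri x1
      -- If this area vanished, `x` would lie on the side from `v` to `c`, hence in the neighbouring
      -- closed part, and would be a vertex of that part.
      have p1 : 0 < ar (π v) (π x) (π c) := by
        refine lt_of_le_of_ne hx1.2.1 fun h0 => x2 (h.mem_cell₂ hx ?_)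
        exact (convex_inClosedTri _ _ _).segment_subset (inClosedTri_corners h2.ar_pos).2.1
          (inClosedTri_corners h2.ar_pos).2.2 (hx1.mem_segment h1.ar_pos h0.symm)
      have p2 : 0 < ar (π v) (π b) (π x) := by
        refine lt_of_le_of_ne hx1.2.2 fun h0 => x3 (h.mem_cell₃ hx ?_)
        refine (convex_inClosedTri _ _ _).segment_subset (inClosedTri_corners h3.ar_pos).2.1
          (inClosedTri_corners h3.ar_pos).2.2 (hx1.rot.mem_segment ?_ ?_)
        · rw [← ar_rot]; exact h1.ar_pos
        · rw [← ar_rot]; exact h0.symm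
      obtain ⟨p, hp, hpx, hpy, hp' | hp'⟩ := exists_exit h1.ar_pos hx1.1 (h.inClosedTri hy).1 p1 p2
        (fun hin => y1 (h.mem_cell₁ hy hin))
      · exact ⟨v, c, hedge c (by simp), p, ⟨hp, hp'⟩, hpx, hpy⟩
      · exact ⟨v, b, hedge b (by simp), p, ⟨hp, hp'⟩, hpx, hpy⟩
    have exit₂ : ∀ x ∈ verts t₂ a v c, x ∉ verts t₁ v b c → x ∉ verts t₃ a b v →
        ∀ y ∈ verts (node v t₁ t₂ t₃) a b c, y ∉ verts t₂ a v c →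
        ∃ z w, Edge (node v t₁ t₂ t₃) a b c z w ∧
          ∃ p ∈ segment ℝ (π x) (π y) ∩ segment ℝ (π z) (π w), p ≠ π x ∧ p ≠ π y := by
      intro x x2 x1 x3 y hy y2
      have hx := mem_verts_node.2
        (Or.inr (Or.inl x2) : x ∈ verts t₁ v b c ∨ _ ∨ x ∈ verts t₃ a b v)
      have hx2 := (h2.inClosedTri x2).rot
      have hpos : 0 < ar (π v) (π c) (π a) := by rw [← ar_rot]; exact h2.ar_pos
      have p1 : 0 < ar (π v) (π x) (π a) := by
        refine lt_of_le_of_ne hx2.2.1 fun h0 => x3 (h.mem_cell₃ hx ?_)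
        exact (convex_inClosedTri _ _ _).segment_subset (inClosedTri_corners h3.ar_pos).2.2
          (inClosedTri_corners h3.ar_pos).1 (hx2.mem_segment hpos h0.symm)
      have p2 : 0 < ar (π v) (π c) (π x) := by
        refine lt_of_le_of_ne hx2.2.2 fun h0 => x1 (h.mem_cell₁ hx ?_)
        refine (convex_inClosedTri _ _ _).segment_subset (inClosedTri_corners h1.ar_pos).2.2
          (inClosedTri_corners h1.ar_pos).1 (hx2.rot.mem_segment ?_ ?_)
        · rw [← ar_rot]; exact hpos
        · rw [← ar_rot]; exact h0.symm
      obtain ⟨p, hp, hpx, hpy, hp' | hp'⟩ := exists_exit hpos hx2.1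
        (h.inClosedTri hy).rot.1 p1 p2
        (fun hin => y2 (h.mem_cell₂ hy hin.rot.rot))
      · exact ⟨v, a, hedge a (by simp), p, ⟨hp, hp'⟩, hpx, hpy⟩
      · exact ⟨v, c, hedge c (by simp), p, ⟨hp, hp'⟩, hpx, hpy⟩
    have exit₃ : ∀ x ∈ verts t₃ a b v, x ∉ verts t₁ v b c → x ∉ verts t₂ a v c →
        ∀ y ∈ verts (node v t₁ t₂ t₃) a b c, y ∉ verts t₃ a b v →
        ∃ z w, Edge (node v t₁ t₂ t₃) a b c z w ∧
          ∃ p ∈ segment ℝ (π x) (π y) ∩ segment ℝ (π z) (π w), p ≠ π x ∧ p ≠ π y := by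
      intro x x3 x1 x2 y hy y3
      have hx := mem_verts_node.2
        (Or.inr (Or.inr x3) : x ∈ verts t₁ v b c ∨ x ∈ verts t₂ a v c ∨ _)
      have hx3 := (h3.inClosedTri x3).rot.rot
      have hpos : 0 < ar (π v) (π a) (π b) := by rw [ar_rot]; exact h3.ar_pos
      have p1 : 0 < ar (π v) (π x) (π b) := by
        refine lt_of_le_of_ne hx3.2.1 fun h0 => x1 (h.mem_cell₁ hx ?_)
        exact (convex_inClosedTri _ _ _).segment_subset (inClosedTri_corners h1.ar_pos).1
          (inClosedTri_corners h1.ar_pos).2.1 (hx3.mem_segment hpos h0.symm)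
      have p2 : 0 < ar (π v) (π a) (π x) := by
        refine lt_of_le_of_ne hx3.2.2 fun h0 => x2 (h.mem_cell₂ hx ?_)
        refine (convex_inClosedTri _ _ _).segment_subset (inClosedTri_corners h2.ar_pos).1
          (inClosedTri_corners h2.ar_pos).2.1 (hx3.rot.mem_segment ?_ ?_)
        · rw [← ar_rot]; exact hpos
        · rw [← ar_rot]; exact h0.symm
      obtain ⟨p, hp, hpx, hpy, hp' | hp'⟩ := exists_exit hpos hx3.1
        (h.inClosedTri hy).rot.rot.1 p1 p2
        (fun hin => y3 (h.mem_cell₃ hy hin.rot))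
      · exact ⟨v, b, hedge b (by simp), p, ⟨hp, hp'⟩, hpx, hpy⟩
      · exact ⟨v, a, hedge a (by simp), p, ⟨hp, hp'⟩, hpx, hpy⟩
    have hswap : (∃ z w, Edge (node v t₁ t₂ t₃) a b c z w ∧
          ∃ p ∈ segment ℝ (π y) (π x) ∩ segment ℝ (π z) (π w), p ≠ π y ∧ p ≠ π x) →
        ∃ z w, Edge (node v t₁ t₂ t₃) a b c z w ∧
          ∃ p ∈ segment ℝ (π x) (π y) ∩ segment ℝ (π z) (π w), p ≠ π x ∧ p ≠ π y := by
      rintro ⟨z, w, he, p, hp, hpy, hpx⟩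
      exact ⟨z, w, he, p, by rwa [segment_symm ℝ (π x)], hpx, hpy⟩
    by_cases s1 : x ∈ verts t₁ v b c ∧ y ∈ verts t₁ v b c
    · obtain ⟨z, w, he, hp⟩ := ih₁ h1 x s1.1 y s1.2 hxy hne.1
      exact ⟨z, w, Or.inl he, hp⟩
    by_cases s2 : x ∈ verts t₂ a v c ∧ y ∈ verts t₂ a v c
    · obtain ⟨z, w, he, hp⟩ := ih₂ h2 x s2.1 y s2.2 hxy hne.2.1
      exact ⟨z, w, Or.inr (Or.inl he), hp⟩
    by_cases s3 : x ∈ verts t₃ a b v ∧ y ∈ verts t₃ a b v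
    · obtain ⟨z, w, he, hp⟩ := ih₃ h3 x s3.1 y s3.2 hxy hne.2.2
      exact ⟨z, w, Or.inr (Or.inr he), hp⟩
    -- With no part in common, one endpoint belongs to a single part: if `x` lies in two parts, only
    -- the third is left for `y`.
    have hcases : ∀ X₁ X₂ X₃ Y₁ Y₂ Y₃ : Prop, (X₁ ∨ X₂ ∨ X₃) → (Y₁ ∨ Y₂ ∨ Y₃) →
        ¬ (X₁ ∧ Y₁) → ¬ (X₂ ∧ Y₂) → ¬ (X₃ ∧ Y₃) →
        ((X₁ ∧ ¬ X₂ ∧ ¬ X₃ ∧ ¬ Y₁) ∨ (X₂ ∧ ¬ X₁ ∧ ¬ X₃ ∧ ¬ Y₂) ∨ (X₃ ∧ ¬ X₁ ∧ ¬ X₂ ∧ ¬ Y₃)) ∨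
        ((Y₁ ∧ ¬ Y₂ ∧ ¬ Y₃ ∧ ¬ X₁) ∨ (Y₂ ∧ ¬ Y₁ ∧ ¬ Y₃ ∧ ¬ X₂) ∨ (Y₃ ∧ ¬ Y₁ ∧ ¬ Y₂ ∧ ¬ X₃)) := by
      intros
      grind
    rcases hcases _ _ _ _ _ _ (mem_verts_node.1 hx) (mem_verts_node.1 hy) s1 s2 s3 with
      (⟨m, n₁, n₂, n₃⟩ | ⟨m, n₁, n₂, n₃⟩ | ⟨m, n₁, n₂, n₃⟩) |
      (⟨m, n₁, n₂, n₃⟩ | ⟨m, n₁, n₂, n₃⟩ | ⟨m, n₁, n₂, n₃⟩)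
    · exact exit₁ x m n₁ n₂ y hy n₃
    · exact exit₂ x m n₁ n₂ y hy n₃
    · exact exit₃ x m n₁ n₂ y hy n₃
    · exact hswap (exit₁ y m n₁ n₂ x hx n₃)
    · exact hswap (exit₂ y m n₁ n₂ x hx n₃)
    · exact hswap (exit₃ y m n₁ n₂ x hx n₃)

/-! ### Faces are the empty clockwise triangles -/

theorem Face.edges {t : Stack α} : ∀ {a b c x y z : α}, Valid π t a b c → Face t a b c x y z →
    Edge t a b c x y ∧ Edge t a b c y z ∧ Edge t a b c z x := by
  induction t with
  | leaf =>
    intro a b c x y z h hf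
    have he := h.edges
    rcases hf with ⟨rfl, rfl, rfl⟩ | ⟨rfl, rfl, rfl⟩ | ⟨rfl, rfl, rfl⟩ <;> tauto
  | node v t₁ t₂ t₃ ih₁ ih₂ ih₃ =>
    rintro a b c x y z ⟨-, h1, h2, h3⟩ (hf | hf | hf)
    · have := ih₁ h1 hf; simp only [Edge]; tauto
    · have := ih₂ h2 hf; simp only [Edge]; tauto
    · have := ih₃ h3 hf; simp only [Edge]; tauto

theorem Face.ar_pos {t : Stack α} : ∀ {a b c x y z : α}, Valid π t a b c → Face t a b c x y z →
    0 < ar (π x) (π y) (π z) := by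
  induction t with
  | leaf =>
    intro a b c x y z h hf
    have h := h.ar_pos
    rcases hf with ⟨rfl, rfl, rfl⟩ | ⟨rfl, rfl, rfl⟩ | ⟨rfl, rfl, rfl⟩
    · exact h
    · rwa [ar_rot] at h
    · rwa [ar_rot, ar_rot] at h
  | node v t₁ t₂ t₃ ih₁ ih₂ ih₃ =>
    rintro a b c x y z ⟨-, h1, h2, h3⟩ (hf | hf | hf)
    · exact ih₁ h1 hf
    · exact ih₂ h2 hf
    · exact ih₃ h3 hf

/-- A face stays inside its part, so by `Valid.mem_cell₁` and its analogues a vertex in the face is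
a vertex of that part, and induction applies. -/
theorem Face.empty {t : Stack α} : ∀ {a b c x y z : α}, Valid π t a b c → Face t a b c x y z →
    ∀ p ∈ verts t a b c, InClosedTri (π x) (π y) (π z) (π p) → p = x ∨ p = y ∨ p = z := by
  induction t with
  | leaf =>
    intro a b c x y z h hf p hp _
    simp only [verts, inner, Set.union_empty, Set.mem_insert_iff, Set.mem_singleton_iff] at hp
    rcases hf with ⟨rfl, rfl, rfl⟩ | ⟨rfl, rfl, rfl⟩ | ⟨rfl, rfl, rfl⟩ <;> tauto
  | node v t₁ t₂ t₃ ih₁ ih₂ ih₃ =>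
    have aux : ∀ {t : Stack α} {a b c x y z : α} {p : Plane}, Valid π t a b c →
        Face t a b c x y z → InClosedTri (π x) (π y) (π z) p →
        InClosedTri (π a) (π b) (π c) p := by
      intro t a b c x y z p h hf hp
      obtain ⟨e1, e2, e3⟩ := hf.edges h
      have hx := h.inClosedTri e1.mem_left
      have hy := h.inClosedTri e2.mem_left
      have hz := h.inClosedTri e3.mem_left
      have hpos := hf.ar_pos h
      refine convexHull_min ?_ (convex_inClosedTri (π a) (π b) (π c)) (hp.mem_convexHull hpos)
      rintro q (rfl | rfl | rfl) <;> assumption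
    rintro a b c x y z h (hf | hf | hf) p hp hin
    · exact ih₁ h.2.1 hf p (h.mem_cell₁ hp (aux h.2.1 hf hin)) hin
    · exact ih₂ h.2.2.1 hf p (h.mem_cell₂ hp (aux h.2.2.1 hf hin)) hin
    · exact ih₃ h.2.2.2 hf p (h.mem_cell₃ hp (aux h.2.2.2 hf hin)) hin

section cells

variable {v : α} {t₁ t₂ t₃ : Stack α} {a b c : α}

theorem Valid.verts₁₂ (h : Valid π (node v t₁ t₂ t₃) a b c) {x : α}
    (hx : x ∈ verts t₁ v b c) (hx' : x ∈ verts t₂ a v c) : x = v ∨ x = c := by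
  obtain ⟨hv, h1, h2, h3⟩ := h
  have hin := h2.inClosedTri hx'
  rcases hx with (rfl | rfl | rfl) | hx
  · exact Or.inl rfl
  · have := hin.2.2
    have := hv.2.2
    simp only [ar] at *; linarith
  · exact Or.inr rfl
  · have := (h1.inTri x hx).2.1
    have := hin.1
    simp only [ar] at *; linarith

theorem Valid.verts₁₃ (h : Valid π (node v t₁ t₂ t₃) a b c) {x : α}
    (hx : x ∈ verts t₁ v b c) (hx' : x ∈ verts t₃ a b v) : x = v ∨ x = b := by
  obtain ⟨hv, h1, h2, h3⟩ := h
  have hin := h3.inClosedTri hx'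
  rcases hx with (rfl | rfl | rfl) | hx
  · exact Or.inl rfl
  · exact Or.inr rfl
  · have := hin.2.1
    have := hv.2.1
    simp only [ar] at *; linarith
  · have := (h1.inTri x hx).2.2
    have := hin.1
    simp only [ar] at *; linarith

theorem Valid.verts₂₃ (h : Valid π (node v t₁ t₂ t₃) a b c) {x : α}
    (hx : x ∈ verts t₂ a v c) (hx' : x ∈ verts t₃ a b v) : x = v ∨ x = a := by
  obtain ⟨hv, h1, h2, h3⟩ := h
  have hin := h3.inClosedTri hx'
  rcases hx with (rfl | rfl | rfl) | hx
  · exact Or.inr rfl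
  · exact Or.inl rfl
  · have := hin.1
    have := hv.1
    simp only [ar] at *; linarith
  · have := (h2.inTri x hx).2.2
    have := hin.2.1
    simp only [ar] at *; linarith

theorem edge_of_mem_pair {t : Stack α} {a b c v k x y : α} (hk : Edge t a b c v k) (hxy : x ≠ y)
    (hx : x = v ∨ x = k) (hy : y = v ∨ y = k) : Edge t a b c x y := by
  rcases hx with rfl | rfl <;> rcases hy with rfl | rfl
  · exact (hxy rfl).elim
  · exact hk
  · exact hk.symm
  · exact (hxy rfl).elim

/-- An edge of another part with both ends in this one must be the side common to the two parts, and
that side is an edge of both. -/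
theorem Valid.edge₁ (h : Valid π (node v t₁ t₂ t₃) a b c) {x y : α}
    (he : Edge (node v t₁ t₂ t₃) a b c x y) (hx : x ∈ verts t₁ v b c)
    (hy : y ∈ verts t₁ v b c) : Edge t₁ v b c x y := by
  rcases he with he | he | he
  · exact he
  · exact edge_of_mem_pair h.2.1.edges.2.2.symm he.ne (h.verts₁₂ hx he.mem_left)
      (h.verts₁₂ hy he.mem_right)
  · exact edge_of_mem_pair h.2.1.edges.1 he.ne (h.verts₁₃ hx he.mem_left)
      (h.verts₁₃ hy he.mem_right)

theorem Valid.edge₂ (h : Valid π (node v t₁ t₂ t₃) a b c) {x y : α}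
    (he : Edge (node v t₁ t₂ t₃) a b c x y) (hx : x ∈ verts t₂ a v c)
    (hy : y ∈ verts t₂ a v c) : Edge t₂ a v c x y := by
  rcases he with he | he | he
  · exact edge_of_mem_pair h.2.2.1.edges.2.1 he.ne (h.verts₁₂ he.mem_left hx)
      (h.verts₁₂ he.mem_right hy)
  · exact he
  · exact edge_of_mem_pair h.2.2.1.edges.1.symm he.ne (h.verts₂₃ hx he.mem_left)
      (h.verts₂₃ hy he.mem_right)

theorem Valid.edge₃ (h : Valid π (node v t₁ t₂ t₃) a b c) {x y : α}
    (he : Edge (node v t₁ t₂ t₃) a b c x y) (hx : x ∈ verts t₃ a b v)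
    (hy : y ∈ verts t₃ a b v) : Edge t₃ a b v x y := by
  rcases he with he | he | he
  · exact edge_of_mem_pair h.2.2.2.edges.2.1.symm he.ne (h.verts₁₃ he.mem_left hx)
      (h.verts₁₃ he.mem_right hy)
  · exact edge_of_mem_pair h.2.2.2.edges.2.2 he.ne (h.verts₂₃ he.mem_left hx)
      (h.verts₂₃ he.mem_right hy)
  · exact he

end cells

/-- An empty clockwise triangle of edges is a face. -/
theorem Valid.face {t : Stack α} : ∀ {a b c x y z : α}, Valid π t a b c →
    Edge t a b c x y → Edge t a b c y z → Edge t a b c z x → 0 < ar (π x) (π y) (π z) →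
    (∀ p ∈ verts t a b c, π p ∈ convexHull ℝ ({π x, π y, π z} : Set Plane) →
      p = x ∨ p = y ∨ p = z) → Face t a b c x y z := by
  induction t with
  | leaf =>
    rintro a b c x y z h ⟨hxy, hx, hy⟩ ⟨hyz, -, hz⟩ ⟨hzx, -, -⟩ hpos -
    have h : 0 < ar (π a) (π b) (π c) := h
    rcases hx with rfl | rfl | rfl <;> rcases hy with rfl | rfl | rfl <;>
      rcases hz with rfl | rfl | rfl <;>
      first
        | exact (hxy rfl).elim
        | exact (hyz rfl).elim
        | exact (hzx rfl).elim
        | (exfalso; simp only [ar] at *; linarith)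
        | simp [Face]
  | node v t₁ t₂ t₃ ih₁ ih₂ ih₃ =>
    intro a b c x y z h exy eyz ezx hpos hemp
    obtain ⟨hv, h1, h2, h3⟩ := id h
    by_cases s1 : x ∈ verts t₁ v b c ∧ y ∈ verts t₁ v b c ∧ z ∈ verts t₁ v b c
    · obtain ⟨hx, hy, hz⟩ := s1
      exact Or.inl (ih₁ h1 (h.edge₁ exy hx hy) (h.edge₁ eyz hy hz) (h.edge₁ ezx hz hx) hpos
        fun p hp => hemp p (mem_verts_node.2 (Or.inl hp)))
    by_cases s2 : x ∈ verts t₂ a v c ∧ y ∈ verts t₂ a v c ∧ z ∈ verts t₂ a v c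
    · obtain ⟨hx, hy, hz⟩ := s2
      exact Or.inr (Or.inl (ih₂ h2 (h.edge₂ exy hx hy) (h.edge₂ eyz hy hz) (h.edge₂ ezx hz hx) hpos
        fun p hp => hemp p (mem_verts_node.2 (Or.inr (Or.inl hp)))))
    by_cases s3 : x ∈ verts t₃ a b v ∧ y ∈ verts t₃ a b v ∧ z ∈ verts t₃ a b v
    · obtain ⟨hx, hy, hz⟩ := s3
      exact Or.inr (Or.inr (ih₃ h3 (h.edge₃ exy hx hy) (h.edge₃ eyz hy hz) (h.edge₃ ezx hz hx) hpos
        fun p hp => hemp p (mem_verts_node.2 (Or.inr (Or.inr hp)))))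
    exfalso
    -- the sides lie in different parts, so the triangle is the outer one
    have hpair : ∀ {x y}, Edge (node v t₁ t₂ t₃) a b c x y →
        (x ∈ verts t₁ v b c ∧ y ∈ verts t₁ v b c) ∨ (x ∈ verts t₂ a v c ∧ y ∈ verts t₂ a v c) ∨
        (x ∈ verts t₃ a b v ∧ y ∈ verts t₃ a b v) := by
      rintro x y (e | e | e)
      · exact Or.inl ⟨e.mem_left, e.mem_right⟩
      · exact Or.inr (Or.inl ⟨e.mem_left, e.mem_right⟩)
      · exact Or.inr (Or.inr ⟨e.mem_left, e.mem_right⟩)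
    have m12 := fun x => @Valid.verts₁₂ _ _ _ _ _ _ _ _ _ h x
    have m13 := fun x => @Valid.verts₁₃ _ _ _ _ _ _ _ _ _ h x
    have m23 := fun x => @Valid.verts₂₃ _ _ _ _ _ _ _ _ _ h x
    have v1 : v ∈ verts t₁ v b c := by simp [verts]
    have v2 : v ∈ verts t₂ a v c := by simp [verts]
    have v3 : v ∈ verts t₃ a b v := by simp [verts]
    -- Every two of the three vertices share a part, but no part contains all three. So the sides
    -- lie in three different parts and each vertex lies in two of them, which leaves `v` and the
    -- corners; `v` is excluded because it lies in all parts.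
    have hall : (x = a ∨ x = b ∨ x = c) ∧ (y = a ∨ y = b ∨ y = c) ∧ (z = a ∨ z = b ∨ z = c) ∧
        v ≠ x ∧ v ≠ y ∧ v ≠ z := by
      have p1 := hpair exy
      have p2 := hpair eyz
      have p3 := hpair ezx
      clear hpair hemp ih₁ ih₂ ih₃ h h1 h2 h3 hv hpos exy eyz ezx
      grind
    obtain ⟨hx, hy, hz, nx, ny, nz⟩ := hall
    have hmem := hv.closed.mem_convexHull h.ar_pos
    have hsub : ({π a, π b, π c} : Set Plane) ⊆ {π x, π y, π z} := by
      have := exy.ne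
      have := eyz.ne
      have := ezx.ne
      have : (a = x ∨ a = y ∨ a = z) ∧ (b = x ∨ b = y ∨ b = z) ∧ (c = x ∨ c = y ∨ c = z) := by
        clear hemp ih₁ ih₂ ih₃ h h1 h2 h3 hv hpos exy eyz ezx m12 m13 m23 s1 s2 s3 hpair
        grind
      obtain ⟨qa, qb, qc⟩ := this
      rintro q (rfl | rfl | rfl)
      · rcases qa with rfl | rfl | rfl <;> simp
      · rcases qb with rfl | rfl | rfl <;> simp
      · rcases qc with rfl | rfl | rfl <;> simp
    rcases hemp v (mem_verts_node.2 (Or.inl v1)) (convexHull_mono hsub hmem) with h | h | h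
    · exact nx h
    · exact ny h
    · exact nz h

end Stack
end CompatTri

/-! ### From stacked triangulations to graphs on point sets -/

namespace CompatTri
namespace Stack

variable {α : Type*} {π : α → Plane} {t : Stack α} {a b c : α} {P : Finset Plane}

/-- The edges of a stacked triangulation, as a graph on the positions of the vertices. -/
def graph (t : Stack α) (a b c : α) (e : verts t a b c ≃ P) : SimpleGraph P where
  Adj p q := Edge t a b c (e.symm p) (e.symm q)
  symm := ⟨fun _ _ h => Edge.symm h⟩
  loopless := ⟨fun _ h => Edge.ne h rfl⟩

/-- For maximality: an additional segment crosses an edge away from its own endpoints, and a larger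
non-crossing graph would contain both. -/
theorem Valid.isTriangulation (h : Valid π t a b c) (e : verts t a b c ≃ P)
    (he : ∀ x, (e x : Plane) = π x) : IsTriangulation (graph t a b c e) := by
  have hpos : ∀ p : P, (p : Plane) = π (e.symm p) := fun p => by
    rw [← he, Equiv.apply_symm_apply]
  have hinj : ∀ p q : P, ((e.symm p : α) = e.symm q) → p = q := fun p q hpq =>
    e.symm.injective (Subtype.ext hpq)
  constructor
  · intro p q r s hpq hrs hne
    have hne' : s((e.symm p : α), (e.symm q : α)) ≠ s((e.symm r : α), (e.symm s : α)) := by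
      intro heq
      apply hne
      rcases Sym2.eq_iff.1 heq with ⟨h1, h2⟩ | ⟨h1, h2⟩
      · rw [hinj _ _ h1, hinj _ _ h2]
      · rw [hinj _ _ h1, hinj _ _ h2, Sym2.eq_swap]
    have := h.crossFree _ _ _ _ hpq hrs hne'
    rwa [← hpos, ← hpos, ← hpos, ← hpos] at this
  · intro H hH hle p q hpq
    by_contra hnot
    obtain ⟨z, w, hzw, u, hu, hux, huy⟩ := h.exists_crossing _ (e.symm p).2 _ (e.symm q).2
      (fun heq => hpq.ne (hinj _ _ heq)) hnot
    have hzw' : (graph t a b c e).Adj (e ⟨z, hzw.mem_left⟩) (e ⟨w, hzw.mem_right⟩) := by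
      simpa [graph] using hzw
    have hne : s(p, q) ≠ s(e ⟨z, hzw.mem_left⟩, e ⟨w, hzw.mem_right⟩) := by
      intro heq
      apply hnot
      rcases Sym2.eq_iff.1 heq with ⟨rfl, rfl⟩ | ⟨rfl, rfl⟩
      · exact hzw'
      · exact hzw'.symm
    rw [← hpos, ← hpos] at hu
    have := (hH _ _ _ _ hpq (hle hzw') hne ⟨hu.1, by rw [he, he]; exact hu.2⟩).1
    rcases this with h1 | h1
    · exact hux (h1.trans (hpos p))
    · exact huy (h1.trans (hpos q))

/-- The right-hand side does not involve `π`; this is what makes two realizations compatible. -/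
theorem Valid.isClockwiseTriangle_iff (h : Valid π t a b c) (e : verts t a b c ≃ P)
    (he : ∀ x, (e x : Plane) = π x) (p q r : P) :
    IsClockwiseTriangle (graph t a b c e) p q r ↔
      Face t a b c (e.symm p) (e.symm q) (e.symm r) := by
  have hpos : ∀ p : P, (p : Plane) = π (e.symm p) := fun p => by
    rw [← he, Equiv.apply_symm_apply]
  rw [IsClockwiseTriangle, clockwise_iff, hpos p, hpos q, hpos r]
  constructor
  · rintro ⟨e1, e2, e3, hcw, hemp⟩
    refine h.face e1 e2 e3 hcw fun x hx hin => ?_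
    have := hemp (e ⟨x, hx⟩) (by rwa [he])
    rcases this with rfl | rfl | rfl <;> simp
  · intro hf
    obtain ⟨e1, e2, e3⟩ := hf.edges h
    refine ⟨e1, e2, e3, hf.ar_pos h, fun s hs => ?_⟩
    have hin := inClosedTri_of_mem_convexHull (hf.ar_pos h) hs
    rw [hpos s] at hin
    have hinj : ∀ p q : P, ((e.symm p : α) = e.symm q) → p = q := fun p q hpq =>
      e.symm.injective (Subtype.ext hpq)
    exact (hf.empty h _ (e.symm s).2 hin).imp (hinj _ _) (Or.imp (hinj _ _) (hinj _ _))

/-- Two realizations of a stacked triangulation give compatible triangulations. -/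
theorem Valid.exists_compatible {π' : α → Plane} {Q : Finset Plane} (h : Valid π t a b c)
    (h' : Valid π' t a b c) (hP : π '' verts t a b c = P) (hQ : π' '' verts t a b c = Q) :
    ∃ (G : SimpleGraph P) (H : SimpleGraph Q) (f : P ≃ Q),
      IsTriangulation G ∧ IsTriangulation H ∧ CompatibleVia G H f ∧
      ∀ p : P, ∃ x ∈ verts t a b c, (p : Plane) = π x ∧ (f p : Plane) = π' x := by
  have hb : Set.BijOn π (verts t a b c) P := hP ▸ h.injOn.bijOn_image
  have hb' : Set.BijOn π' (verts t a b c) Q := hQ ▸ h'.injOn.bijOn_image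
  let e : verts t a b c ≃ P := hb.equiv π
  let e' : verts t a b c ≃ Q := hb'.equiv π'
  have he : ∀ x, (e x : Plane) = π x := fun x => rfl
  have he' : ∀ x, (e' x : Plane) = π' x := fun x => rfl
  refine ⟨graph t a b c e, graph t a b c e', e.symm.trans e', h.isTriangulation e he,
    h'.isTriangulation e' he', fun p q r => ?_, fun p => ⟨e.symm p, (e.symm p).2, ?_, ?_⟩⟩
  · rw [h.isClockwiseTriangle_iff e he, h'.isClockwiseTriangle_iff e' he']
    simp
  · rw [← he, Equiv.apply_symm_apply]
  · rw [← he']; rfl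

end Stack

/-! ### Points avoiding finitely many lines -/

/-- No three distinct points of `W` are collinear, in terms of signed areas. -/
def Generic (W : Finset Plane) : Prop :=
  ∀ x ∈ W, ∀ y ∈ W, ∀ z ∈ W, x ≠ y → x ≠ z → y ≠ z → ar x y z ≠ 0

theorem generalPosition_iff {W : Finset Plane} : GeneralPosition W ↔ Generic W := by
  simp only [GeneralPosition, Generic, collinear_iff_ar_eq_zero, ne_eq]

/-- `g` is an affine function of the coordinates. -/
def IsAffineFun (g : Plane → ℝ) : Prop :=
  ∃ l m k : ℝ, ∀ p, g p = l * p 0 + m * p 1 + k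

/-- Density: from a zero of `g`, any small move towards a point where `g` does not vanish leaves the
zero set, since `g` is linear along that ray. -/
theorem IsAffineFun.isOpen_dense {g : Plane → ℝ} (hg : IsAffineFun g) (hne : ∃ p, g p ≠ 0) :
    IsOpen {p | g p ≠ 0} ∧ Dense {p | g p ≠ 0} := by
  obtain ⟨l, m, k, hg⟩ := hg
  obtain ⟨q, hq⟩ := hne
  have hc : Continuous g := by
    have : g = fun p => l * p 0 + m * p 1 + k := funext hg
    rw [this]; fun_prop
  refine ⟨isOpen_ne_fun hc continuous_const, ?_⟩
  intro p
  by_cases hp : g p = 0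
  · have hlim : Filter.Tendsto (fun s : ℝ => p + s • (q - p)) (nhdsWithin 0 {0}ᶜ) (nhds p) := by
      have : Filter.Tendsto (fun s : ℝ => p + s • (q - p)) (nhds 0) (nhds (p + (0 : ℝ) • (q - p))) :=
        Continuous.tendsto (by fun_prop) 0
      rw [zero_smul, add_zero] at this
      exact this.mono_left nhdsWithin_le_nhds
    refine mem_closure_of_tendsto hlim ?_
    filter_upwards [self_mem_nhdsWithin] with s hs
    have : g (p + s • (q - p)) = s * g q + (1 - s) * g p := by
      simp only [hg]; simp; ring
    change g (p + s • (q - p)) ≠ 0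
    rw [this, hp, mul_zero, add_zero]
    exact mul_ne_zero hs hq
  · exact subset_closure hp

theorem exists_avoiding {U : Set Plane} (hU : IsOpen U) (hne : U.Nonempty)
    {F : Set (Plane → ℝ)} (hF : F.Finite) (hg : ∀ g ∈ F, IsAffineFun g ∧ ∃ p, g p ≠ 0) :
    ∃ p ∈ U, ∀ g ∈ F, g p ≠ 0 := by
  have hd : Dense (⋂ g ∈ F, {p : Plane | g p ≠ 0}) :=
    dense_biInter_of_isOpen (fun g h => ((hg g h).1.isOpen_dense (hg g h).2).1) hF.countable
      (fun g h => ((hg g h).1.isOpen_dense (hg g h).2).2)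
  obtain ⟨p, hp, hpU⟩ := hd.inter_open_nonempty U hU hne
  exact ⟨p, hp, fun g h => by simpa using Set.mem_iInter₂.1 hpU g h⟩

theorem isAffineFun_ar (x y : Plane) : IsAffineFun fun p => ar x y p :=
  ⟨y 1 - x 1, -(y 0 - x 0), -(y 1 - x 1) * x 0 + (y 0 - x 0) * x 1, fun p => by
    simp only [ar]; ring⟩

theorem exists_ar_ne_zero {x y : Plane} (h : x ≠ y) : ∃ p, ar x y p ≠ 0 := by
  by_contra! hcon
  have h0 := hcon (x + !₂[1, 0])
  have h1 := hcon (x + !₂[0, 1])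
  simp [ar] at h0 h1
  apply h
  ext i
  fin_cases i <;> simp <;> linarith

open scoped Classical in
/-- A generic point of a nonempty open set. -/
theorem exists_generic {U : Set Plane} (hU : IsOpen U) (hne : U.Nonempty) {W : Finset Plane}
    (hW : Generic W) {F : Set (Plane → ℝ)} (hF : F.Finite)
    (hg : ∀ g ∈ F, IsAffineFun g ∧ ∃ p, g p ≠ 0) :
    ∃ p ∈ U, p ∉ W ∧ Generic (insert p W) ∧ ∀ g ∈ F, g p ≠ 0 := by
  -- Avoiding the vertical lines through the points of `W` guarantees that the new point is not in
  -- `W`.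
  have hF1 : ((fun w : Plane => fun p : Plane => p 0 - w 0) '' (W : Set Plane)).Finite :=
    W.finite_toSet.image _
  have hF2 : ((fun w : Plane × Plane => fun p : Plane => ar w.1 w.2 p) ''
      {w | w ∈ W ×ˢ W ∧ w.1 ≠ w.2}).Finite :=
    (Set.Finite.subset (W ×ˢ W).finite_toSet (fun w hw => hw.1)).image _
  obtain ⟨p, hpU, hp⟩ := exists_avoiding hU hne ((hF1.union hF2).union hF) (by
    rintro g ((⟨w, -, rfl⟩ | ⟨w, ⟨-, hw⟩, rfl⟩) | hgF)
    · exact ⟨⟨1, 0, -w 0, fun p => by ring⟩, w + !₂[1, 0], by simp⟩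
    · exact ⟨isAffineFun_ar _ _, exists_ar_ne_zero hw⟩
    · exact hg g hgF)
  have hpW : p ∉ W := fun hpW => hp _ (Or.inl (Or.inl ⟨p, hpW, rfl⟩)) (by simp)
  have hkey : ∀ x ∈ W, ∀ y ∈ W, x ≠ y → ar x y p ≠ 0 := fun x hx y hy hxy =>
    hp _ (Or.inl (Or.inr ⟨(x, y), ⟨Finset.mk_mem_product hx hy, hxy⟩, rfl⟩))
  refine ⟨p, hpU, hpW, ?_, fun g hg => hp g (Or.inr hg)⟩
  intro x hx y hy z hz hxy hxz hyz
  rw [Finset.mem_insert] at hx hy hz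
  rcases hx with rfl | hx
  · rw [ar_rot]
    exact hkey y (hy.resolve_left hxy.symm) z (hz.resolve_left hxz.symm) hyz
  rcases hy with rfl | hy
  · rw [← ar_rot]
    exact hkey z (hz.resolve_left hyz.symm) x hx hxz.symm
  rcases hz with rfl | hz
  · exact hkey x hx y hy hxy
  · exact hW x hx y hy z hz hxy hxz hyz

/-! ### Splitting the points of a triangle into one, one and the rest -/

section thresholds

variable {β : Type*} {S : Finset β} {X Y : β → ℝ} {p q r : β}

open scoped Classical in
-- Take `η` just above `Y q` and `ξ` just below `X r`. All points except `p` then exceed `ξ` in `X`,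
-- all except `p` and `q` exceed `η` in `Y`, and the strict inequality `hlt` survives the small
-- change.
theorem exists_thresholds_of_lt (hX : ∀ s ∈ S, 0 < X s) (hY : ∀ s ∈ S, 0 < Y s) (hp : p ∈ S)
    (hq : q ∈ S) (hpr : X p < X r) (hrmin : ∀ s ∈ S, s ≠ p → X r ≤ X s)
    (hqp : q ≠ p) (hqmin : ∀ s ∈ S, s ≠ p → s ≠ q → Y q < Y s) (hlt : X p * Y q < Y p * X r) :
    ∃ ξ η, 0 < ξ ∧ 0 < η ∧ X p < ξ ∧ η * X p < ξ * Y p ∧ Y q < η ∧ ξ * Y q < η * X q ∧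
      ∀ s ∈ S, s ≠ p → s ≠ q → ξ < X s ∧ η < Y s := by
  have h1 : ∀ᶠ η in nhdsWithin (Y q) (Set.Ioi (Y q)),
      ∀ s ∈ (S.erase p).erase q, η < Y s := by
    rw [Filter.eventually_all_finset]
    intro s hs
    rw [Finset.mem_erase, Finset.mem_erase] at hs
    exact (eventually_lt_nhds (hqmin s hs.2.2 hs.2.1 hs.1)).filter_mono nhdsWithin_le_nhds
  have h2 : ∀ᶠ η in nhdsWithin (Y q) (Set.Ioi (Y q)), X p * η < Y p * X r := by
    have hc : Filter.Tendsto (fun η => X p * η) (nhds (Y q)) (nhds (X p * Y q)) :=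
      Continuous.tendsto (by fun_prop) _
    exact (hc.eventually (eventually_lt_nhds hlt)).filter_mono nhdsWithin_le_nhds
  obtain ⟨η, ⟨h1, h2⟩, h3⟩ := ((h1.and h2).and self_mem_nhdsWithin).exists
  have h3 : Y q < η := h3
  have h4 : ∀ᶠ ξ in nhdsWithin (X r) (Set.Iio (X r)), X p < ξ :=
    (eventually_gt_nhds hpr).filter_mono nhdsWithin_le_nhds
  have h5 : ∀ᶠ ξ in nhdsWithin (X r) (Set.Iio (X r)), X p * η < Y p * ξ := by
    have hc : Filter.Tendsto (fun ξ => Y p * ξ) (nhds (X r)) (nhds (Y p * X r)) :=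
      Continuous.tendsto (by fun_prop) _
    exact (hc.eventually (eventually_gt_nhds h2)).filter_mono nhdsWithin_le_nhds
  obtain ⟨ξ, ⟨h4, h5⟩, h6⟩ := ((h4.and h5).and self_mem_nhdsWithin).exists
  have h6 : ξ < X r := h6
  have hYq := hY q hq
  have hξ : 0 < ξ := (hX p hp).trans h4
  refine ⟨ξ, η, hξ, hYq.trans h3, h4, by linarith, h3, ?_, fun s hs hsp hsq => ⟨?_, ?_⟩⟩
  · have := hrmin q hq hqp
    have hξq : ξ < X q := by linarith
    calc ξ * Y q < ξ * η := by gcongr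
      _ = η * ξ := mul_comm _ _
      _ < η * X q := by gcongr; linarith
  · exact h6.trans_le (hrmin s hs hsp)
  · exact h1 s (by simp [hs, hsp, hsq])

open scoped Classical in
-- The coordinates are to be read as barycentric ratios: the conclusion says that the point with
-- ratios `ξ` and `η` isolates `p` and `q` in two of the three parts. The points `q` and `r` of the
-- proof may coincide, so `hC` allows this.
theorem exists_thresholds (hcard : 2 ≤ S.card) (hX : ∀ s ∈ S, 0 < X s) (hY : ∀ s ∈ S, 0 < Y s)
    (iX : Set.InjOn X S) (iY : Set.InjOn Y S)
    (hC : ∀ p ∈ S, ∀ q ∈ S, ∀ r ∈ S, p ≠ q → p ≠ r → X p * Y q ≠ Y p * X r) :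
    ∃ ξ η, 0 < ξ ∧ 0 < η ∧ ∃ p ∈ S, ∃ q ∈ S, p ≠ q ∧
      X p < ξ ∧ η * X p < ξ * Y p ∧ Y q < η ∧ ξ * Y q < η * X q ∧
      ∀ s ∈ S, s ≠ p → s ≠ q → ξ < X s ∧ η < Y s := by
  obtain ⟨p, hp, hpmin⟩ := S.exists_min_image X (Finset.card_pos.1 (by omega))
  have hne : (S.erase p).Nonempty := by
    rw [← Finset.card_pos, Finset.card_erase_of_mem hp]; omega
  obtain ⟨r, hr, hrmin⟩ := (S.erase p).exists_min_image X hne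
  obtain ⟨q, hq, hqmin⟩ := (S.erase p).exists_min_image Y hne
  rw [Finset.mem_erase] at hr hq
  have hpr : X p < X r :=
    lt_of_le_of_ne (hpmin r hr.2) fun h => hr.1 (iX hp hr.2 h).symm
  have hrmin' : ∀ s ∈ S, s ≠ p → X r ≤ X s := fun s hs hsp => hrmin s (by simp [hs, hsp])
  have hqmin' : ∀ s ∈ S, s ≠ p → Y q ≤ Y s := fun s hs hsp => hqmin s (by simp [hs, hsp])
  rcases lt_or_gt_of_ne (hC p hp q hq.2 r hr.2 hq.1.symm hr.1.symm) with hlt | hlt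
  · obtain ⟨ξ, η, hξ, hη, h⟩ := exists_thresholds_of_lt hX hY hp hq.2 hpr hrmin' hq.1
      (fun s hs hsp hsq => lt_of_le_of_ne (hqmin' s hs hsp) fun h => hsq (iY hq.2 hs h).symm) hlt
    exact ⟨ξ, η, hξ, hη, p, hp, q, hq.2, hq.1.symm, h⟩
  -- Here `p` also minimizes `Y`, because `X p < X r`. So the roles of `X` and `Y`, and with them
  -- those of `q` and `r`, can be exchanged.
  · have hpq : Y p < Y q := by
      have h1 := hX p hp
      have h2 := hY p hp
      have h3 : X p * Y p < X p * Y q := by nlinarith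
      exact lt_of_mul_lt_mul_left h3 h1.le
    obtain ⟨η, ξ, hη, hξ, h1, h2, h3, h4, h5⟩ := exists_thresholds_of_lt hY hX hp hr.2 hpq
      hqmin' hr.1 (fun s hs hsp hsr => lt_of_le_of_ne (hrmin' s hs hsp) fun h =>
        hsr (iX hr.2 hs h).symm) hlt
    exact ⟨ξ, η, hξ, hη, r, hr.2, p, hp, hr.1, h3, h4, h1, h2,
      fun s hs hsr hsp => (h5 s hs hsp hsr).symm⟩

end thresholds

/-- No three lines joining the corners of a triangle to different points of `S` are concurrent. -/
def CevaGeneric (a b c : Plane) (S : Finset Plane) : Prop :=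
  ∀ p ∈ S, ∀ q ∈ S, ∀ r ∈ S, p ≠ q → p ≠ r → q ≠ r →
    ar a b r * ar c p q - ar q b r * ar c p a ≠ 0

theorem CevaGeneric.mono {a b c : Plane} {S S' : Finset Plane} (h : CevaGeneric a b c S)
    (hs : S' ⊆ S) : CevaGeneric a b c S' :=
  fun p hp q hq r hr => h p (hs hp) q (hs hq) r (hs hr)

theorem InTri.ne {a b c p : Plane} (h : InTri a b c p) : p ≠ a ∧ p ≠ b ∧ p ≠ c := by
  obtain ⟨h1, h2, h3⟩ := h
  refine ⟨?_, ?_, ?_⟩ <;> rintro rfl <;> simp_all [ar_self_left, ar_self_outer]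

theorem isOpen_inTri {X : Type*} [TopologicalSpace X] {f g h k : X → Plane} (hf : Continuous f)
    (hg : Continuous g) (hh : Continuous h) (hk : Continuous k) :
    IsOpen {x | InTri (f x) (g x) (h x) (k x)} := by
  simp only [InTri]
  exact (isOpen_lt continuous_const (by fun_prop)).and
    ((isOpen_lt continuous_const (by fun_prop)).and (isOpen_lt continuous_const (by fun_prop)))

/-- Some point splits the points of a triangle into one, one, and the remaining ones. -/
theorem exists_split {a b c : Plane} {S W : Finset Plane} (hcard : 2 ≤ S.card) (hSW : S ⊆ W)
    (ha : a ∈ W) (hb : b ∈ W) (hc : c ∈ W) (hW : Generic W) (hin : ∀ p ∈ S, InTri a b c p)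
    (hceva : CevaGeneric a b c S) :
    ∃ v, ∃ p ∈ S, ∃ q ∈ S, p ≠ q ∧ InTri a b c v ∧ InTri v b c p ∧ InTri a v c q ∧
      ∀ s ∈ S, s ≠ p → s ≠ q → InTri a b v s := by
  -- The ratios of the barycentric weights at `a` and at `b` to the weight at `c`. Equal first
  -- ratios mean collinearity with `b`, equal second ratios collinearity with `a`.
  have hX : ∀ s ∈ S, 0 < ar s b c / ar a b s := fun s hs => div_pos (hin s hs).1 (hin s hs).2.2
  have hY : ∀ s ∈ S, 0 < ar a s c / ar a b s := fun s hs => div_pos (hin s hs).2.1 (hin s hs).2.2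
  have iX : Set.InjOn (fun s => ar s b c / ar a b s) (S : Set Plane) := by
    intro s hs s' hs' h
    by_contra hne
    have h1 := hin s hs
    have h2 := hin s' hs'
    have := hW b hb s (hSW hs) s' (hSW hs') h1.ne.2.1.symm h2.ne.2.1.symm hne
    rw [div_eq_div_iff h1.2.2.ne' h2.2.2.ne'] at h
    have h3 : ar a b c * ar b s s' = 0 := by
      simp only [ar] at h ⊢; linear_combination -h
    exact (mul_ne_zero h1.ar_pos.ne' this) h3
  have iY : Set.InjOn (fun s => ar a s c / ar a b s) (S : Set Plane) := by
    intro s hs s' hs' h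
    by_contra hne
    have h1 := hin s hs
    have h2 := hin s' hs'
    have := hW a ha s (hSW hs) s' (hSW hs') h1.ne.1.symm h2.ne.1.symm hne
    rw [div_eq_div_iff h1.2.2.ne' h2.2.2.ne'] at h
    have h3 : ar a b c * ar a s s' = 0 := by
      simp only [ar] at h ⊢; linear_combination h
    exact (mul_ne_zero h1.ar_pos.ne' this) h3
  obtain ⟨ξ, η, hξ, hη, p, hp, q, hq, hpq, c1, c2, c3, c4, c5⟩ :=
    exists_thresholds hcard hX hY iX iY (by
      intro p hp q hq r hr hpq hpr h
      have h1 := hin p hp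
      have h2 := hin q hq
      have h3 := hin r hr
      rw [div_mul_div_comm, div_mul_div_comm, div_eq_div_iff
        (mul_pos h1.2.2 h2.2.2).ne' (mul_pos h1.2.2 h3.2.2).ne'] at h
      have h4 : ar a b p * (ar a b c * (ar a b r * ar c p q - ar q b r * ar c p a)) = 0 := by
        simp only [ar] at h ⊢; linear_combination h
      have h5 := (mul_eq_zero.1 ((mul_eq_zero.1 h4).resolve_left h1.2.2.ne')).resolve_left
        h1.ar_pos.ne'
      -- For `q = r` concurrency degenerates to collinearity of `c`, `p`, `q`, which `Generic W`
      -- excludes; otherwise it is the Ceva condition.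
      by_cases hqr : q = r
      · subst hqr
        rw [ar_self_outer, zero_mul, sub_zero] at h5
        exact mul_ne_zero h2.2.2.ne' (hW c hc p (hSW hp) q (hSW hq) h1.ne.2.2.symm
          h2.ne.2.2.symm hpq) h5
      · exact hceva p hp q hq r hr hpq hpr hqr h5)
  have hpos : 0 < ar a b c := (hin p hp).ar_pos
  have hδ : 0 < ξ + η + 1 := by positivity
  -- The point whose two ratios are `ξ` and `η`; membership in each part becomes the corresponding
  -- threshold inequality.
  set v : Plane := (ξ + η + 1)⁻¹ • (ξ • a + η • b + c) with hv
  have key : ∀ x y, ar v x y = (ξ + η + 1)⁻¹ * (ξ * ar a x y + η * ar b x y + ar c x y) := by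
    intro x y
    rw [hv]
    simp only [ar, PiLp.smul_apply, PiLp.add_apply, smul_eq_mul]
    field_simp
    ring
  have key' : ∀ x y, ar x v y = (ξ + η + 1)⁻¹ * (ξ * ar x a y + η * ar x b y + ar x c y) := by
    intro x y
    rw [ar_swap, key, ar_swap x a, ar_swap x b, ar_swap x c]; ring
  have key'' : ∀ x y, ar x y v = (ξ + η + 1)⁻¹ * (ξ * ar x y a + η * ar x y b + ar x y c) := by
    intro x y
    rw [← ar_rot v, key, ar_rot a, ar_rot b, ar_rot c]
  have hδ' := inv_pos.2 hδ
  refine ⟨v, p, hp, q, hq, hpq, ⟨?_, ?_, ?_⟩, ⟨(hin p hp).1, ?_, ?_⟩, ⟨?_, (hin q hq).2.1, ?_⟩,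
    fun s hs hsp hsq => ⟨?_, ?_, (hin s hs).2.2⟩⟩
  · rw [key, ar_self_left, ar_self_outer]; simp only [mul_zero, add_zero]; positivity
  · rw [key', ar_self_left, ar_self_right]; simp only [mul_zero, add_zero, zero_add]; positivity
  · rw [key'', ar_self_right, ar_self_outer]; simp only [mul_zero, zero_add]; positivity
  all_goals first | rw [key] | rw [key'] | rw [key'']
  all_goals refine mul_pos hδ' ?_
  · have := (hin p hp).2.2
    rw [mul_div_assoc', mul_div_assoc', div_lt_div_iff_of_pos_right this] at c2
    simp only [ar] at c2 ⊢; linarith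
  · have := (hin p hp).2.2
    rw [div_lt_iff₀ this] at c1
    simp only [ar] at c1 ⊢; linarith
  · have := (hin q hq).2.2
    rw [mul_div_assoc', mul_div_assoc', div_lt_div_iff_of_pos_right this] at c4
    simp only [ar] at c4 ⊢; linarith
  · have := (hin q hq).2.2
    rw [div_lt_iff₀ this] at c3
    simp only [ar] at c3 ⊢; linarith
  · have := (hin s hs).2.2
    have c6 := (c5 s hs hsp hsq).1
    rw [lt_div_iff₀ this] at c6
    simp only [ar] at c6 ⊢; linarith
  · have := (hin s hs).2.2
    have c6 := (c5 s hs hsp hsq).2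
    rw [lt_div_iff₀ this] at c6
    simp only [ar] at c6 ⊢; linarith

/-- The Ceva condition is affine in the third corner, the one that `v` replaces in the recursion, so
it can be secured by avoiding finitely many lines. -/
theorem isAffineFun_ceva (a b p q r : Plane) :
    IsAffineFun fun c => ar a b r * ar c p q - ar q b r * ar c p a := by
  obtain ⟨l, m, k, h⟩ := isAffineFun_ar p q
  obtain ⟨l', m', k', h'⟩ := isAffineFun_ar p a
  refine ⟨ar a b r * l - ar q b r * l', ar a b r * m - ar q b r * m',
    ar a b r * k - ar q b r * k', fun c => ?_⟩
  have e1 : ar c p q = l * c 0 + m * c 1 + k := by rw [ar_rot]; exact h c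
  have e2 : ar c p a = l' * c 0 + m' * c 1 + k' := by rw [ar_rot]; exact h' c
  simp only [e1, e2]; ring

/-- The affine functions whose zeros have to be avoided by the third corner for `CevaGeneric`. -/
def cevaFuns (a b : Plane) (S : Finset Plane) : Set (Plane → ℝ) :=
  (fun w : Plane × Plane × Plane => fun c : Plane =>
    ar a b w.2.2 * ar c w.1 w.2.1 - ar w.2.1 b w.2.2 * ar c w.1 a) ''
    {w | w ∈ S ×ˢ S ×ˢ S ∧ w.1 ≠ w.2.1 ∧ w.1 ≠ w.2.2 ∧ w.2.1 ≠ w.2.2}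

theorem finite_cevaFuns (a b : Plane) (S : Finset Plane) : (cevaFuns a b S).Finite :=
  (Set.Finite.subset (S ×ˢ S ×ˢ S).finite_toSet (fun _ hw => hw.1)).image _

theorem cevaGeneric_of_avoids {a b c : Plane} {S : Finset Plane}
    (h : ∀ g ∈ cevaFuns a b S, g c ≠ 0) : CevaGeneric a b c S :=
  fun p hp q hq r hr hpq hpr hqr => h _ ⟨(p, q, r), ⟨by simp [hp, hq, hr], hpq, hpr, hqr⟩, rfl⟩

theorem cevaFuns_affine {a b : Plane} {S W : Finset Plane} (hSW : S ⊆ W) (ha : a ∈ W)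
    (hb : b ∈ W) (hW : Generic W) (hS : ∀ p ∈ S, p ≠ a ∧ p ≠ b) :
    ∀ g ∈ cevaFuns a b S, IsAffineFun g ∧ ∃ p, g p ≠ 0 := by
  rintro g ⟨⟨p, q, r⟩, ⟨hm, hpq, hpr, hqr⟩, rfl⟩
  simp only [Finset.mem_product] at hm
  obtain ⟨hp, hq, hr⟩ := hm
  -- At `c = q` the first product vanishes and the second is a product of two nonzero areas.
  refine ⟨isAffineFun_ceva a b p q r, q, ?_⟩
  simp only [ar_self_outer, mul_zero, zero_sub, neg_ne_zero]
  exact mul_ne_zero (hW q (hSW hq) b hb r (hSW hr) (hS q hq).2 hqr (hS r hr).2.symm)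
    (hW q (hSW hq) p (hSW hp) a ha hpq.symm (hS q hq).1 (hS p hp).1)

open scoped Classical in
-- The conditions on `v` are strict, so `v` can be moved within an open set to restore general
-- position and the Ceva condition for the triangle of the next round.
theorem exists_generic_split {a b c : Plane} {S W : Finset Plane} (hcard : 2 ≤ S.card)
    (hSW : S ⊆ W) (ha : a ∈ W) (hb : b ∈ W) (hc : c ∈ W) (hW : Generic W)
    (hin : ∀ p ∈ S, InTri a b c p) (hceva : CevaGeneric a b c S) :
    ∃ v, ∃ p ∈ S, ∃ q ∈ S, p ≠ q ∧ InTri a b c v ∧ InTri v b c p ∧ InTri a v c q ∧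
      (∀ s ∈ S, s ≠ p → s ≠ q → InTri a b v s) ∧
      v ∉ W ∧ Generic (insert v W) ∧ CevaGeneric a b v S := by
  obtain ⟨v₀, p, hp, q, hq, hpq, h1, h2, h3, h4⟩ := exists_split hcard hSW ha hb hc hW hin hceva
  have hU : IsOpen ({v | InTri a b c v} ∩ {v | InTri v b c p} ∩ {v | InTri a v c q} ∩
      ⋂ s ∈ (S.erase p).erase q, {v | InTri a b v s}) := by
    refine IsOpen.inter (IsOpen.inter (IsOpen.inter ?_ ?_) ?_)
      (isOpen_biInter_finset fun s _ => ?_) <;> apply isOpen_inTri <;> fun_prop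
  have hS : ∀ p ∈ S, p ≠ a ∧ p ≠ b := fun p hp => ⟨(hin p hp).ne.1, (hin p hp).ne.2.1⟩
  obtain ⟨v, ⟨⟨⟨v1, v2⟩, v3⟩, v4⟩, hvW, hgen, hF⟩ := exists_generic hU
    ⟨v₀, ⟨⟨h1, h2⟩, h3⟩, Set.mem_iInter₂.2 fun s hs => by
      rw [Finset.mem_erase, Finset.mem_erase] at hs
      exact h4 s hs.2.2 hs.2.1 hs.1⟩ hW (finite_cevaFuns a b S)
    (cevaFuns_affine hSW ha hb hW hS)
  refine ⟨v, p, hp, q, hq, hpq, v1, v2, v3, fun s hs hsp hsq => ?_, hvW, hgen,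
    cevaGeneric_of_avoids hF⟩
  exact Set.mem_iInter₂.1 v4 s (by simp [hs, hsp, hsq])

/-! ### One stacked triangulation for two point sets -/

open scoped Classical in
/-- Two point sets of the same size, each inside a triangle, are extended by half as many points to
realizations of the same stacked triangulation. -/
theorem exists_stack (n : ℕ) : ∀ (a b c : Plane × Plane) (S T W W' : Finset Plane),
    S.card = n → T.card = n → S ⊆ W → T ⊆ W' → a.1 ∈ W → b.1 ∈ W → c.1 ∈ W →
    a.2 ∈ W' → b.2 ∈ W' → c.2 ∈ W' → Generic W → Generic W' →
    0 < ar a.1 b.1 c.1 → 0 < ar a.2 b.2 c.2 →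
    (∀ p ∈ S, InTri a.1 b.1 c.1 p) → (∀ p ∈ T, InTri a.2 b.2 c.2 p) →
    CevaGeneric a.1 b.1 c.1 S → CevaGeneric a.2 b.2 c.2 T →
    ∃ (t : Stack (Plane × Plane)) (A B : Finset Plane), A.card = n / 2 ∧ B.card = n / 2 ∧
      Disjoint W A ∧ Disjoint W' B ∧ Generic (W ∪ A) ∧ Generic (W' ∪ B) ∧
      t.Valid Prod.fst a b c ∧ t.Valid Prod.snd a b c ∧
      Prod.fst '' t.inner = (S ∪ A : Finset Plane) ∧ Prod.snd '' t.inner = (T ∪ B : Finset Plane) ∧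
      ∀ x ∈ t.inner, (x.1 ∈ S ↔ x.2 ∈ T) := by
  induction n using Nat.strong_induction_on with
  | _ n ih =>
  intro a b c S T W W' hSn hTn hSW hTW ha hb hc ha' hb' hc' hW hW' hpos hpos' hS hT hcS hcT
  rcases Nat.lt_or_ge n 1 with hn | hn
  · obtain rfl : n = 0 := by omega
    obtain rfl := Finset.card_eq_zero.1 hSn
    obtain rfl := Finset.card_eq_zero.1 hTn
    exact ⟨.leaf, ∅, ∅, by simp [Stack.inner, Stack.Valid, hW, hW', hpos, hpos']⟩
  rcases Nat.lt_or_ge n 2 with hn2 | hn2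
  · obtain rfl : n = 1 := by omega
    obtain ⟨p, rfl⟩ := Finset.card_eq_one.1 hSn
    obtain ⟨q, rfl⟩ := Finset.card_eq_one.1 hTn
    have hp := hS p (by simp)
    have hq := hT q (by simp)
    refine ⟨.node (p, q) .leaf .leaf .leaf, ∅, ∅, ?_⟩
    simp [Stack.inner, Stack.Valid, hW, hW', hp, hq, hp.1, hp.2.1, hp.2.2, hq.1, hq.2.1, hq.2.2]
  obtain ⟨v, p, hp, q, hq, hpq, v1, v2, v3, v4, hvW, hgen, hcv⟩ :=
    exists_generic_split (hSn ▸ hn2) hSW ha hb hc hW hS hcS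
  obtain ⟨v', p', hp', q', hq', hpq', v1', v2', v3', v4', hvW', hgen', hcv'⟩ :=
    exists_generic_split (hTn ▸ hn2) hTW ha' hb' hc' hW' hT hcT
  have hS3 : (S.erase p).erase q ⊆ S := (Finset.erase_subset _ _).trans (Finset.erase_subset _ _)
  have hT3 : (T.erase p').erase q' ⊆ T :=
    (Finset.erase_subset _ _).trans (Finset.erase_subset _ _)
  have hcard : ((S.erase p).erase q).card = n - 2 := by
    rw [Finset.card_erase_of_mem (Finset.mem_erase.2 ⟨hpq.symm, hq⟩), Finset.card_erase_of_mem hp,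
      hSn]; omega
  have hcard' : ((T.erase p').erase q').card = n - 2 := by
    rw [Finset.card_erase_of_mem (Finset.mem_erase.2 ⟨hpq'.symm, hq'⟩),
      Finset.card_erase_of_mem hp', hTn]; omega
  -- `W` and `W'` collect all points placed so far, so the later Steiner points are new and in
  -- general position with respect to them.
  obtain ⟨t, A, B, hA, hB, dA, dB, gA, gB, val, val', im, im', hiff⟩ :=
    ih (n - 2) (by omega) a b (v, v') _ _ (insert v W) (insert v' W') hcard hcard'
      (hS3.trans (hSW.trans (Finset.subset_insert _ _)))
      (hT3.trans (hTW.trans (Finset.subset_insert _ _)))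
      (Finset.mem_insert_of_mem ha) (Finset.mem_insert_of_mem hb) (Finset.mem_insert_self _ _)
      (Finset.mem_insert_of_mem ha') (Finset.mem_insert_of_mem hb') (Finset.mem_insert_self _ _)
      hgen hgen' v1.2.2 v1'.2.2
      (fun s hs => by
        rw [Finset.mem_erase, Finset.mem_erase] at hs
        exact v4 s hs.2.2 hs.2.1 hs.1)
      (fun s hs => by
        rw [Finset.mem_erase, Finset.mem_erase] at hs
        exact v4' s hs.2.2 hs.2.1 hs.1)
      (hcv.mono hS3) (hcv'.mono hT3)
  rw [Finset.disjoint_insert_left] at dA dB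
  have himage : ∀ (S A : Finset Plane) (p q v : Plane), p ∈ S → q ∈ S →
      (insert v (insert p (insert q (((S.erase p).erase q ∪ A : Finset Plane) : Set Plane)))) =
      ((S ∪ insert v A : Finset Plane) : Set Plane) := by
    intro S A p q v hp hq
    ext x
    simp only [Finset.coe_union, Finset.coe_insert, Finset.coe_erase, Set.mem_insert_iff,
      Set.mem_union, Set.mem_sdiff, Finset.mem_coe, Set.mem_singleton_iff]
    constructor
    · rintro (rfl | rfl | rfl | h) <;> tauto
    · tauto
  have hinner : Stack.inner (.node (v, v') (.node (p, p') .leaf .leaf .leaf)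
      (.node (q, q') .leaf .leaf .leaf) t) =
      insert (v, v') (insert (p, p') (insert (q, q') t.inner)) := by
    ext x
    simp only [Stack.inner, Set.mem_insert_iff, Set.mem_union, Set.mem_empty_iff_false]
    tauto
  -- Steiner point is paired with Steiner point, and each isolated point with the isolated point of
  -- the same part.
  refine ⟨.node (v, v') (.node (p, p') .leaf .leaf .leaf) (.node (q, q') .leaf .leaf .leaf) t,
    insert v A, insert v' B, ?_, ?_, ?_, ?_, ?_, ?_, ?_, ?_, ?_, ?_, ?_⟩
  · rw [Finset.card_insert_of_notMem dA.1, hA]; omega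
  · rw [Finset.card_insert_of_notMem dB.1, hB]; omega
  · exact Finset.disjoint_insert_right.2 ⟨hvW, dA.2⟩
  · exact Finset.disjoint_insert_right.2 ⟨hvW', dB.2⟩
  · rwa [Finset.union_insert, ← Finset.insert_union]
  · rwa [Finset.union_insert, ← Finset.insert_union]
  · exact ⟨v1, ⟨v2, v2.1, v2.2.1, v2.2.2⟩, ⟨v3, v3.1, v3.2.1, v3.2.2⟩, val⟩
  · exact ⟨v1', ⟨v2', v2'.1, v2'.2.1, v2'.2.2⟩, ⟨v3', v3'.1, v3'.2.1, v3'.2.2⟩, val'⟩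
  · rw [hinner, Set.image_insert_eq, Set.image_insert_eq, Set.image_insert_eq, im]
    exact himage S A p q v hp hq
  · rw [hinner, Set.image_insert_eq, Set.image_insert_eq, Set.image_insert_eq, im']
    exact himage T B p' q' v' hp' hq'
  · rw [hinner]
    rintro x (rfl | rfl | rfl | hx)
    · exact iff_of_false (fun h => hvW (hSW h)) (fun h => hvW' (hTW h))
    · exact iff_of_true hp hp'
    · exact iff_of_true hq hq'
    -- The recursion only compares membership in the reduced sets. Disjointness of `W` and `A` shows
    -- that a vertex lying in `S` is not a Steiner point, hence lies in the reduced set.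
    · have h1 : x.1 ∈ (S.erase p).erase q ∪ A := by
        rw [← Finset.mem_coe, ← im]; exact Set.mem_image_of_mem _ hx
      have h2 : x.2 ∈ (T.erase p').erase q' ∪ B := by
        rw [← Finset.mem_coe, ← im']; exact Set.mem_image_of_mem _ hx
      have h3 := hiff x hx
      rw [Finset.mem_union] at h1 h2
      constructor
      · intro h
        exact hT3 (h3.1 (h1.resolve_right fun h' => Finset.disjoint_left.1 dA.2 (hSW h) h'))
      · intro h
        exact hS3 (h3.2 (h2.resolve_right fun h' => Finset.disjoint_left.1 dB.2 (hTW h) h'))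

/-! ### Enclosing disks and triangles -/

theorem radius_le {P : Finset Plane} {z : Plane} {r : ℝ} (hr : 0 ≤ r)
    (h : ∀ p ∈ P, dist p z ≤ r) : radius P ≤ r :=
  csInf_le ⟨0, fun _ hx => hx.1⟩ ⟨hr, z, fun p hp => h p hp⟩

/-- The smallest enclosing disk exists. -/
theorem exists_center {P : Finset Plane} (hP : P.Nonempty) :
    ∃ z : Plane, ∀ p ∈ P, dist p z ≤ radius P := by
  let f : Plane → ℝ := fun z => P.sup' hP fun p => dist p z
  have hf : Continuous f := Continuous.finset_sup'_apply hP fun p _ => by fun_prop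
  obtain ⟨p₀, hp₀⟩ := hP
  have hle : ∀ p ∈ P, ∀ z, dist p z ≤ f z := fun p hp z =>
    Finset.le_sup' (fun p => dist p z) hp
  -- The largest distance to `P` is continuous and tends to infinity, so it attains its minimum.
  have hlim : Filter.Tendsto f (Filter.cocompact Plane) Filter.atTop :=
    Filter.tendsto_atTop_mono (hle p₀ hp₀) (tendsto_dist_left_cocompact_atTop p₀)
  obtain ⟨z, hz⟩ := hf.exists_forall_le hlim
  refine ⟨z, fun p hp => (hle p hp z).trans ?_⟩
  have hbound : ∀ r z', (∀ p ∈ P, dist p z' ≤ r) → f z ≤ r := fun r z' h =>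
    (hz z').trans (Finset.sup'_le _ _ h)
  refine le_csInf ⟨f z, dist_nonneg.trans (hle p₀ hp₀ z), z, fun p hp => hle p hp z⟩ ?_
  rintro r ⟨-, z', hz'⟩
  exact hbound r z' fun p hp => hz' hp

theorem radius_pos {P : Finset Plane} (hP : 2 ≤ P.card) : 0 < radius P := by
  obtain ⟨p, hp, q, hq, hpq⟩ := Finset.one_lt_card.1 hP
  obtain ⟨z, hz⟩ := exists_center ⟨p, hp⟩
  have h := dist_triangle_right p q z
  have h1 := hz p hp
  have h2 := hz q hq
  have h3 := dist_pos.2 hpq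
  linarith

theorem dist_sq_eq (p q : Plane) : dist p q ^ 2 = (p 0 - q 0) ^ 2 + (p 1 - q 1) ^ 2 := by
  rw [EuclideanSpace.dist_eq, Real.sq_sqrt (by positivity), Fin.sum_univ_two, Real.dist_eq,
    Real.dist_eq, sq_abs, sq_abs]

/-- The equality case of the Cauchy–Schwarz inequality: only the touching point itself lies on the
tangent line. -/
theorem inner_lt_of_ne {w₀ w₁ x y r : ℝ} (hr : 0 < r) (hw : w₀ ^ 2 + w₁ ^ 2 ≤ r ^ 2)
    (hu : x ^ 2 + y ^ 2 = 1) (hne : ¬ (w₀ = r * x ∧ w₁ = r * y)) : w₀ * x + w₁ * y < r := by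
  by_contra! hcon
  apply hne
  have h : (w₀ - r * x) ^ 2 + (w₁ - r * y) ^ 2 ≤ 0 := by
    have h1 : (w₀ - r * x) ^ 2 + (w₁ - r * y) ^ 2 =
        (w₀ ^ 2 + w₁ ^ 2) - 2 * (r * (w₀ * x + w₁ * y)) + r ^ 2 * (x ^ 2 + y ^ 2) := by ring
    have h2 : r * r ≤ r * (w₀ * x + w₁ * y) := by gcongr
    rw [h1, hu]; nlinarith
  have h0 : w₀ - r * x = 0 := by nlinarith [sq_nonneg (w₀ - r * x), sq_nonneg (w₁ - r * y)]
  have h1 : w₁ - r * y = 0 := by nlinarith [sq_nonneg (w₀ - r * x), sq_nonneg (w₁ - r * y)]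
  constructor <;> linarith

/-- A finite subset of a closed disk lies inside a triangle with corners inside the concentric disk
of twice the radius. -/
theorem exists_triangle {S : Finset Plane} {z : Plane} {r : ℝ} (hr : 0 < r)
    (hS : ∀ p ∈ S, dist p z ≤ r) :
    ∃ a b c : Plane, dist a z < 2 * r ∧ dist b z < 2 * r ∧ dist c z < 2 * r ∧
      ∀ p ∈ S, InTri a b c p := by
  set s : ℝ := √3 / 2 with hs
  have hs2 : s ^ 2 = 3 / 4 := by rw [hs, div_pow, Real.sq_sqrt (by norm_num)]; norm_num
  have hs0 : 0 < s := by positivity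
  -- an equilateral circumscribed triangle touching the circle in no point of `S`
  have hbad : ((fun p : Plane => (p 0 - z 0) / r) '' (S : Set Plane) ∪
      (fun p : Plane => (-(p 0 - z 0) / 2 - s * (p 1 - z 1)) / r) '' (S : Set Plane) ∪
      (fun p : Plane => (-(p 0 - z 0) / 2 + s * (p 1 - z 1)) / r) '' (S : Set Plane)).Finite :=
    ((S.finite_toSet.image _).union (S.finite_toSet.image _)).union (S.finite_toSet.image _)
  -- The three sides have unit normals obtained from (x, y) by rotation through 0° and ±120°. Each
  -- of the three maps recovers `x` from a touching point, so only finitely many values are bad.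
  obtain ⟨x, hx, hxbad⟩ := ((Set.Icc_infinite (zero_lt_one' ℝ)).sdiff hbad).nonempty
  simp only [Set.mem_union, Set.mem_image, Finset.mem_coe, not_or, not_exists, not_and] at hxbad
  obtain ⟨⟨bad0, bad1⟩, bad2⟩ := hxbad
  obtain ⟨y, hy⟩ : ∃ y : ℝ, x ^ 2 + y ^ 2 = 1 := by
    refine ⟨√(1 - x ^ 2), ?_⟩
    rw [Real.sq_sqrt (by nlinarith [hx.1, hx.2])]; ring
  have hw : ∀ p ∈ S, (p 0 - z 0) ^ 2 + (p 1 - z 1) ^ 2 ≤ r ^ 2 := fun p hp => by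
    rw [← dist_sq_eq]
    exact pow_le_pow_left₀ dist_nonneg (hS p hp) 2
  have hlt : ∀ p ∈ S, (p 0 - z 0) * x + (p 1 - z 1) * y < r ∧
      (p 0 - z 0) * (-x / 2 + s * y) + (p 1 - z 1) * (-s * x - y / 2) < r ∧
      (p 0 - z 0) * (-x / 2 - s * y) + (p 1 - z 1) * (s * x - y / 2) < r := by
    intro p hp
    refine ⟨inner_lt_of_ne hr (hw p hp) hy ?_, inner_lt_of_ne hr (hw p hp) ?_ ?_,
      inner_lt_of_ne hr (hw p hp) ?_ ?_⟩
    · rintro ⟨h0, h1⟩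
      apply bad0 p hp
      rw [h0]; field_simp
    · linear_combination (1 / 4 + s ^ 2) * hy + hs2
    · rintro ⟨h0, h1⟩
      apply bad1 p hp
      rw [h0, h1, div_eq_iff hr.ne']
      linear_combination r * x * hs2
    · linear_combination (1 / 4 + s ^ 2) * hy + hs2
    · rintro ⟨h0, h1⟩
      apply bad2 p hp
      rw [h0, h1, div_eq_iff hr.ne']
      linear_combination r * x * hs2
  -- All points are now strictly inside, so the triangle can be shrunk to inradius `ρ < r`, which
  -- brings its corners strictly within distance `2 * r`.
  have hev : ∀ᶠ ρ in nhdsWithin r (Set.Iio r), (0 < ρ ∧ ∀ p ∈ S,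
      (p 0 - z 0) * x + (p 1 - z 1) * y < ρ ∧
      (p 0 - z 0) * (-x / 2 + s * y) + (p 1 - z 1) * (-s * x - y / 2) < ρ ∧
      (p 0 - z 0) * (-x / 2 - s * y) + (p 1 - z 1) * (s * x - y / 2) < ρ) := by
    refine Filter.Eventually.filter_mono nhdsWithin_le_nhds ?_
    refine (eventually_gt_nhds hr).and ((Filter.eventually_all_finset S).2 fun p hp => ?_)
    obtain ⟨h1, h2, h3⟩ := hlt p hp
    exact (eventually_gt_nhds h1).and ((eventually_gt_nhds h2).and (eventually_gt_nhds h3))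
  obtain ⟨ρ, ⟨hρ, hρS⟩, hρr⟩ := (hev.and self_mem_nhdsWithin).exists
  have hρr : ρ < r := hρr
  have hdist : ∀ u v : ℝ, u ^ 2 + v ^ 2 = 1 →
      dist (!₂[z 0 - 2 * ρ * u, z 1 - 2 * ρ * v] : Plane) z < 2 * r := by
    intro u v huv
    refine lt_of_pow_lt_pow_left₀ 2 (by positivity) ?_
    rw [dist_sq_eq]
    simp only [Matrix.cons_val_zero, Matrix.cons_val_one]
    have : (z 0 - 2 * ρ * u - z 0) ^ 2 + (z 1 - 2 * ρ * v - z 1) ^ 2 = (2 * ρ) ^ 2 := by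
      linear_combination (2 * ρ) ^ 2 * huv
    rw [this]
    gcongr
  -- Each corner is opposite to the tangent side with the corresponding normal, at distance `2 * ρ`
  -- from the center.
  refine ⟨!₂[z 0 - 2 * ρ * x, z 1 - 2 * ρ * y],
    !₂[z 0 - 2 * ρ * (-x / 2 + s * y), z 1 - 2 * ρ * (-s * x - y / 2)],
    !₂[z 0 - 2 * ρ * (-x / 2 - s * y), z 1 - 2 * ρ * (s * x - y / 2)],
    hdist _ _ hy, hdist _ _ ?_, hdist _ _ ?_, fun p hp => ?_⟩
  · linear_combination (1 / 4 + s ^ 2) * hy + hs2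
  · linear_combination (1 / 4 + s ^ 2) * hy + hs2
  · obtain ⟨h1, h2, h3⟩ := hρS p hp
    -- The side length is `4 * s * ρ`; multiplied by the distance of `p` from a side it gives the
    -- area in `InTri`.
    have hρs : 0 < 4 * s * ρ := by positivity
    refine ⟨?_, ?_, ?_⟩
    · refine lt_of_lt_of_eq (mul_pos hρs (sub_pos.2 h1)) ?_
      simp only [ar, Matrix.cons_val_zero, Matrix.cons_val_one]
      linear_combination (-4 * s * ρ ^ 2) * hy
    · refine lt_of_lt_of_eq (mul_pos hρs (sub_pos.2 h2)) ?_
      simp only [ar, Matrix.cons_val_zero, Matrix.cons_val_one]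
      linear_combination (-4 * s * ρ ^ 2) * hy -
        4 * ρ * ((p 0 - z 0) * y - (p 1 - z 1) * x) * hs2
    · refine lt_of_lt_of_eq (mul_pos hρs (sub_pos.2 h3)) ?_
      simp only [ar, Matrix.cons_val_zero, Matrix.cons_val_one]
      linear_combination (-4 * s * ρ ^ 2) * hy +
        4 * ρ * ((p 0 - z 0) * y - (p 1 - z 1) * x) * hs2

open scoped Classical in
-- All conditions on the corners are open, so they are perturbed one at a time; the last one also
-- takes care of the Ceva condition.
theorem exists_generic_triangle {S : Finset Plane} (hcard : 2 ≤ S.card) (hgen : Generic S) :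
    ∃ z a b c : Plane, (∀ p ∈ S, dist p z ≤ 2 * radius S) ∧
      (dist a z ≤ 2 * radius S ∧ dist b z ≤ 2 * radius S ∧ dist c z ≤ 2 * radius S) ∧
      (∀ p ∈ S, InTri a b c p) ∧ a ∉ S ∧ b ∉ insert a S ∧ c ∉ insert b (insert a S) ∧
      Generic (insert c (insert b (insert a S))) ∧ CevaGeneric a b c S := by
  have hr := radius_pos hcard
  obtain ⟨z, hz⟩ := exists_center (P := S) (Finset.card_pos.1 (by omega))
  obtain ⟨a₀, b₀, c₀, ha₀, hb₀, hc₀, h₀⟩ := exists_triangle hr hz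
  have hopen : ∀ f g h : Plane → Plane, Continuous f → Continuous g → Continuous h →
      IsOpen (Metric.ball z (2 * radius S) ∩ ⋂ p ∈ S, {x | InTri (f x) (g x) (h x) p}) :=
    fun f g h hf hg hh => Metric.isOpen_ball.inter
      (isOpen_biInter_finset fun p _ => isOpen_inTri hf hg hh continuous_const)
  have hnone : ∀ g ∈ (∅ : Set (Plane → ℝ)), IsAffineFun g ∧ ∃ p, g p ≠ 0 := fun g hg => hg.elim
  obtain ⟨a, ⟨ha, hain⟩, haS, hga, -⟩ := exists_generic
    (hopen id (fun _ => b₀) (fun _ => c₀) (by fun_prop) (by fun_prop) (by fun_prop))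
    ⟨a₀, ha₀, Set.mem_iInter₂.2 h₀⟩ hgen Set.finite_empty hnone
  obtain ⟨b, ⟨hb, hbin⟩, hbS, hgb, -⟩ := exists_generic
    (hopen (fun _ => a) id (fun _ => c₀) (by fun_prop) (by fun_prop) (by fun_prop))
    ⟨b₀, hb₀, Set.mem_iInter₂.2 fun p hp => Set.mem_iInter₂.1 hain p hp⟩ hga Set.finite_empty hnone
  obtain ⟨c, ⟨hc, hcin⟩, hcS, hgc, hF⟩ := exists_generic
    (hopen (fun _ => a) (fun _ => b) id (by fun_prop) (by fun_prop) (by fun_prop))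
    ⟨c₀, hc₀, Set.mem_iInter₂.2 fun p hp => Set.mem_iInter₂.1 hbin p hp⟩ hgb (finite_cevaFuns a b S)
    (cevaFuns_affine (W := insert b (insert a S))
      ((Finset.subset_insert _ _).trans (Finset.subset_insert _ _)) (by simp) (by simp) hgb
      fun p hp => ⟨by rintro rfl; exact haS hp,
        by rintro rfl; exact hbS (Finset.mem_insert_of_mem hp)⟩)
  exact ⟨z, a, b, c, fun p hp => (hz p hp).trans (by linarith),
    ⟨(Metric.mem_ball.1 ha).le, (Metric.mem_ball.1 hb).le, (Metric.mem_ball.1 hc).le⟩,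
    Set.mem_iInter₂.1 hcin, haS, hbS, hcS, hgc, cevaGeneric_of_avoids hF⟩

/-! ### Assembling the theorem -/

theorem InTri.dist_le {a b c p z : Plane} {r : ℝ} (h : InTri a b c p) (ha : dist a z ≤ r)
    (hb : dist b z ≤ r) (hc : dist c z ≤ r) : dist p z ≤ r := by
  have hsub : convexHull ℝ ({a, b, c} : Set Plane) ⊆ Metric.closedBall z r := by
    refine convexHull_min ?_ (convex_closedBall z r)
    rintro x (rfl | rfl | rfl) <;> assumption
  exact hsub (h.closed.mem_convexHull h.ar_pos)

open scoped Classical in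
/-- The points added to `S` and the bounds they satisfy, given the corners and the inner points. -/
theorem added_points {n : ℕ} {S A : Finset Plane} {z a b c : Plane} {r : ℝ} (hr : 0 ≤ r)
    (hz : ∀ p ∈ S, dist p z ≤ r) (ha : dist a z ≤ r) (hb : dist b z ≤ r) (hc : dist c z ≤ r)
    (haS : a ∉ S) (hbS : b ∉ insert a S) (hcS : c ∉ insert b (insert a S))
    (hA : A.card = n / 2) (dA : Disjoint (insert c (insert b (insert a S))) A)
    (gA : Generic (insert c (insert b (insert a S)) ∪ A)) (hin : ∀ p ∈ A, InTri a b c p) :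
    ∃ hd : Disjoint S ({a, b, c} ∪ A),
      (({a, b, c} ∪ A : Finset Plane).card : ℝ) ≤ (n : ℝ) / 2 + 3 ∧
      GeneralPosition (S.disjUnion ({a, b, c} ∪ A) hd) ∧
      radius (S.disjUnion ({a, b, c} ∪ A) hd) ≤ r := by
  simp only [Finset.mem_insert, not_or] at hbS hcS
  simp only [Finset.disjoint_insert_left] at dA
  have hd : Disjoint S ({a, b, c} ∪ A) := by
    rw [Finset.disjoint_union_right]
    simp only [Finset.disjoint_insert_right, Finset.disjoint_singleton_right]
    exact ⟨⟨haS, hbS.2, hcS.2.2⟩, dA.2.2.2⟩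
  refine ⟨hd, ?_, ?_, radius_le (z := z) hr fun p hp => ?_⟩
  · have h1 := Finset.card_union_le ({a, b, c} : Finset Plane) A
    have h2 : ({a, b, c} : Finset Plane).card ≤ 3 := Finset.card_le_three
    have h3 : (({a, b, c} ∪ A : Finset Plane).card : ℝ) ≤ ((n / 2 : ℕ) : ℝ) + 3 := by
      exact_mod_cast (by omega : ({a, b, c} ∪ A : Finset Plane).card ≤ n / 2 + 3)
    have h4 : ((n / 2 : ℕ) : ℝ) ≤ (n : ℝ) / 2 := Nat.cast_div_le
    linarith
  · rw [generalPosition_iff]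
    convert gA using 1
    ext x
    simp only [Finset.mem_disjUnion, Finset.mem_union, Finset.mem_insert, Finset.mem_singleton]
    tauto
  · simp only [Finset.mem_disjUnion, Finset.mem_union, Finset.mem_insert,
      Finset.mem_singleton] at hp
    rcases hp with hp | (rfl | rfl | rfl) | hp
    · exact hz p hp
    · exact ha
    · exact hb
    · exact hc
    · exact (hin p hp).dist_le ha hb hc

end CompatTri

open CompatTri in
open scoped Classical in
theorem theorem11 (n : ℕ) (S T : Finset CompatTri.Plane)
    (hS : S.card = n) (hT : T.card = n)
    (hSgen : CompatTri.GeneralPosition S) (hTgen : CompatTri.GeneralPosition T) :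
    ∃ (A B : Finset CompatTri.Plane) (hA : Disjoint S A) (hB : Disjoint T B),
      (A.card : ℝ) ≤ (n : ℝ) / 2 + 3 ∧ (B.card : ℝ) ≤ (n : ℝ) / 2 + 3 ∧
      CompatTri.GeneralPosition (S.disjUnion A hA) ∧
      CompatTri.GeneralPosition (T.disjUnion B hB) ∧
      CompatTri.radius (S.disjUnion A hA) ≤ 2 * CompatTri.radius S ∧
      CompatTri.radius (T.disjUnion B hB) ≤ 2 * CompatTri.radius T ∧
      ∃ (G : SimpleGraph (S.disjUnion A hA)) (H : SimpleGraph (T.disjUnion B hB))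
        (f : (S.disjUnion A hA) ≃ (T.disjUnion B hB)),
        CompatTri.IsTriangulation G ∧ CompatTri.IsTriangulation H ∧
        CompatTri.CompatibleVia G H f ∧
        ∀ p : (S.disjUnion A hA),
          (p : CompatTri.Plane) ∈ S ↔ (f p : CompatTri.Plane) ∈ T := by
  -- For fewer than two points the radius is 0 and no enclosing triangle is allowed; nothing is
  -- added and the triangulations have no edges.
  rcases Nat.lt_or_ge n 2 with hn | hn
  · have hsub : Subsingleton (S.disjUnion ∅ (Finset.disjoint_empty_right S)) := by
      rw [← Fintype.card_le_one_iff_subsingleton]; simp; omega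
    have hsub' : Subsingleton (T.disjUnion ∅ (Finset.disjoint_empty_right T)) := by
      rw [← Fintype.card_le_one_iff_subsingleton]; simp; omega
    have h0 : (0 : ℝ) ≤ (n : ℝ) / 2 + 3 := by positivity
    have hrad : ∀ P : Finset Plane, 0 ≤ radius P := fun P => Real.sInf_nonneg fun x hx => hx.1
    refine ⟨∅, ∅, Finset.disjoint_empty_right S, Finset.disjoint_empty_right T, by simpa using h0,
      by simpa using h0, by simpa using hSgen, by simpa using hTgen,
      by simpa using le_mul_of_one_le_left (hrad S) one_le_two,
      by simpa using le_mul_of_one_le_left (hrad T) one_le_two, ⊥, ⊥,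
      Finset.equivOfCardEq (by simp [hS, hT]), ⟨?_, ?_⟩, ⟨?_, ?_⟩, ?_, fun p => ?_⟩
    · intro a b c d hab; exact hab.elim
    · intro G _ _ a b hab; exact hab.ne (Subsingleton.elim a b)
    · intro a b c d hab; exact hab.elim
    · intro G _ _ a b hab; exact hab.ne (Subsingleton.elim a b)
    · intro a b c
      exact iff_of_false (fun h => h.1) (fun h => h.1)
    · exact iff_of_true
        ((Finset.mem_disjUnion.1 (Subtype.prop p)).resolve_right (Finset.notMem_empty _))
        ((Finset.mem_disjUnion.1 (Subtype.prop _)).resolve_right (Finset.notMem_empty _))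
  have gS := generalPosition_iff.1 hSgen
  have gT := generalPosition_iff.1 hTgen
  obtain ⟨z, a, b, c, hz, ⟨ha, hb, hc⟩, hin, haS, hbS, hcS, hgen, hceva⟩ :=
    exists_generic_triangle (hS ▸ hn) gS
  obtain ⟨z', a', b', c', hz', ⟨ha', hb', hc'⟩, hin', haT, hbT, hcT, hgen', hceva'⟩ :=
    exists_generic_triangle (hT ▸ hn) gT
  have hpos : ∀ {S : Finset Plane} {a b c : Plane}, S.card = n → (∀ p ∈ S, InTri a b c p) →
      0 < ar a b c := fun {S a b c} hS hin => by
    obtain ⟨p, hp⟩ := Finset.card_pos.1 (hS ▸ (by omega) : 0 < S.card)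
    exact (hin p hp).ar_pos
  have hsub : ∀ (S : Finset Plane) (a b c : Plane), S ⊆ insert c (insert b (insert a S)) :=
    fun S a b c x hx => by simp [hx]
  obtain ⟨t, A, B, hA, hB, dA, dB, gA, gB, val, val', im, im', hiff⟩ :=
    exists_stack n (a, a') (b, b') (c, c') S T (insert c (insert b (insert a S)))
      (insert c' (insert b' (insert a' T))) hS hT (hsub S a b c) (hsub T a' b' c')
      (by simp) (by simp) (by simp) (by simp) (by simp) (by simp) hgen hgen'
      (hpos hS hin) (hpos hT hin') hin hin' hceva hceva'
  have hinA : ∀ p ∈ A, InTri a b c p := fun p hp => by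
    obtain ⟨x, hx, rfl⟩ : p ∈ Prod.fst '' t.inner := by rw [im]; simp [hp]
    exact val.inTri x hx
  have hinB : ∀ p ∈ B, InTri a' b' c' p := fun p hp => by
    obtain ⟨x, hx, rfl⟩ : p ∈ Prod.snd '' t.inner := by rw [im']; simp [hp]
    exact val'.inTri x hx
  obtain ⟨hdA, cA, pA, rA⟩ := added_points (by linarith [radius_pos (hS ▸ hn : 2 ≤ S.card)])
    hz ha hb hc haS hbS hcS hA dA gA hinA
  obtain ⟨hdB, cB, pB, rB⟩ := added_points (by linarith [radius_pos (hT ▸ hn : 2 ≤ T.card)])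
    hz' ha' hb' hc' haT hbT hcT hB dB gB hinB
  obtain ⟨G, H, f, hG, hH, hf, hx⟩ := val.exists_compatible val'
    (P := S.disjUnion _ hdA) (Q := T.disjUnion _ hdB)
    (by
      rw [Stack.verts, Set.image_union, im]
      ext x
      simp [Set.image_insert_eq]
      tauto)
    (by
      rw [Stack.verts, Set.image_union, im']
      ext x
      simp [Set.image_insert_eq]
      tauto)
  refine ⟨_, _, hdA, hdB, cA, cB, pA, pB, rA, rB, G, H, f, hG, hH, hf, fun p => ?_⟩
  obtain ⟨x, hxv, hxp, hxf⟩ := hx p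
  rw [hxp, hxf]
  simp only [Finset.mem_insert, not_or] at hbS hcS hbT hcT
  rcases hxv with (rfl | rfl | rfl) | hxi
  · exact iff_of_false haS haT
  · exact iff_of_false hbS.2 hbT.2
  · exact iff_of_false hcS.2.2 hcT.2.2
  · exact hiff x hxi
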